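/- For $m\ge 0$ let $Z_m$ be the zigzag poset on $\{z_1,\dots,z_m\}$ with relations $z_1>z_2<z_3>z_4<\cdots$, and let $E_m$ be the number of linear extensions of $Z_m$ (so $E_0=1$). For $n\ge 1$ let the crown poset $\mathcal C_{2n}$ be $Z_{2n}$ together with the additional relation $z_{2n}<z_1$. For a finite poset $P$ let $\Omega(P;t)\in\mathbb Q[t]$ be its order polynomial: for every $t\in\mathbb N$, $\Omega(P;t)$ is the number of order-preserving maps $P\to\{1,\dots,t\}$. A *convex subposet* of $P$ is a non-empty induced subposet $R$ that is connected and such that $a\le b\le c$ and $a,c\in R$ imply $b\in R$. A *standard decomposition* of $P$ into $k$ convex subposets is a partition of $P$ into $k$ convex subposets for which there are no $r\ge 2$ distinct blocks $P_1,\dots,P_r$ with $P_1\,\tilde\le\, P_2\,\tilde\le\cdots\tilde\le\, P_r\,\tilde\le\, P_1$, where $S\,\tilde\le\, S'$ means that $a\le b$ for some $a\in S$, $b\in S'$. The set of these decompositions is denoted $\mathsf{SDecompo}_k(P)$. Put $$w_+(2j+1)=\frac{(j!)^2}{(2j+1)!}\quad(j\ge 0),\qquad w_-(1)=1,\qquad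 w_-(2j+1)=-\frac{(j!)^2}{2j\,(2j+1)!}\quad(j\ge 1).$$ Call the maximal elements of $\mathcal C_{2n}$ upper and the minimal ones lower. For a block $S$ of a decomposition of $\mathcal C_{2n}$ let $\hat w(S)=0$ if $|S|$ is even, $\hat w(S)=w_-(|S|)$ if $|S|$ is odd and $S$ has more upper than lower elements, and $\hat w(S)=w_+(|S|)$ if $|S|$ is odd and $S$ has more lower than upper elements. Let $\hat w(\mu)=\prod_{S\in\mu}\hat w(S)$. Let $\hat f_{2n,k}=(2n)!\,[t^k]\,\Omega(\mathcal C_{2n};t-\tfrac12)$. Then for all $n\ge 1$ and $1\le k\le 2n$, $$\hat f_{2n,k}=\frac{(2n)!}{2\,(k-1)!}\,E_{k-1}\sum_{\mu\in\mathsf{SDecompo}_k(\mathcal C_{2n})}\hat w(\mu).$$ -/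

import Mathlib

open Polynomial

noncomputable section

/-- The number of surjective order-preserving maps from `P` onto the chain with `j` elements. -/
def surjCount (P : Type) [PartialOrder P] (j : ℕ) : ℕ :=
  Nat.card {f : P →o Fin j // Function.Surjective f}

/-- The number `e(P)` of linear extensions of `P`: surjective order-preserving maps from `P` onto
the chain with `|P|` elements. -/
def numLinearExtensions (P : Type) [PartialOrder P] [Fintype P] : ℕ :=
  surjCount P (Fintype.card P)

/-- The order polynomial `Ω(P; t)`, written in the basis `binom(t, j) = t(t-1)⋯(t-j+1)/j!`.
By `orderPolynomial_eval` its value at every natural number `t` is the number of order-preserving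
maps from `P` to a chain with `t` elements; by `orderPolynomial_unique` it is the only
polynomial with this property. -/
def orderPolynomial (P : Type) [PartialOrder P] [Fintype P] : ℚ[X] :=
  ∑ j ∈ Finset.range (Fintype.card P + 1),
    C ((surjCount P j : ℚ) / (Nat.factorial j : ℚ)) * descPochhammer ℚ j

theorem surjCount_eq_zero (P : Type) [PartialOrder P] [Fintype P] (j : ℕ)
    (hj : Fintype.card P < j) : surjCount P j = 0 := by
  have : IsEmpty {f : P →o Fin j // Function.Surjective f} := by
    refine ⟨fun f => ?_⟩
    have h := Fintype.card_le_of_surjective _ f.2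
    rw [Fintype.card_fin] at h
    omega
  exact Nat.card_of_isEmpty

theorem card_orderHom_image_eq (P : Type) [PartialOrder P] [Fintype P] (t : ℕ)
    (S : Finset (Fin t)) :
    Nat.card {f : P →o Fin t // Finset.univ.image f = S} = surjCount P S.card := by
  symm
  refine Nat.card_congr (Equiv.ofBijective
    (fun g : {f : P →o Fin S.card // Function.Surjective f} =>
      (⟨(S.orderEmbOfFin rfl).toOrderHom.comp g.1, ?_⟩ :
        {f : P →o Fin t // Finset.univ.image f = S})) ⟨?_, ?_⟩)
  · ext x
    simp only [Finset.mem_image, Finset.mem_univ, true_and]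
    constructor
    · rintro ⟨p, rfl⟩
      exact Finset.orderEmbOfFin_mem S rfl _
    · intro hx
      obtain ⟨i, hi⟩ := (S.orderIsoOfFin rfl).surjective ⟨x, hx⟩
      obtain ⟨p, hp⟩ := g.2 i
      refine ⟨p, ?_⟩
      have h2 := congrArg Subtype.val hi
      simpa [hp] using h2
  · rintro ⟨g, hg⟩ ⟨g', hg'⟩ h
    ext p : 3
    have h1 := congrArg (fun f => f.1 p) h
    exact (S.orderEmbOfFin rfl).injective h1
  · rintro ⟨f, hf⟩
    have hmem : ∀ p, f p ∈ S := fun p => by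
      rw [← hf]; exact Finset.mem_image_of_mem _ (Finset.mem_univ p)
    refine ⟨⟨⟨fun p => (S.orderIsoOfFin rfl).symm ⟨f p, hmem p⟩, ?_⟩, ?_⟩, ?_⟩
    · intro p q hpq
      exact (S.orderIsoOfFin rfl).symm.monotone (f.monotone hpq)
    · intro i
      have h1 : ((S.orderIsoOfFin rfl i : S) : Fin t) ∈ Finset.univ.image f := by
        rw [hf]; exact (S.orderIsoOfFin rfl i).2
      obtain ⟨p, -, hp⟩ := Finset.mem_image.1 h1
      refine ⟨p, ?_⟩
      change (S.orderIsoOfFin rfl).symm ⟨f p, hmem p⟩ = i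
      rw [OrderIso.symm_apply_eq]
      exact Subtype.ext hp
    · ext p : 3
      change S.orderEmbOfFin rfl ((S.orderIsoOfFin rfl).symm ⟨f p, hmem p⟩) = f p
      rw [← Finset.coe_orderIsoOfFin_apply, OrderIso.apply_symm_apply]

theorem orderPolynomial_eval (P : Type) [PartialOrder P] [Fintype P] (t : ℕ) :
    (orderPolynomial P).eval (t : ℚ) = (Nat.card (P →o Fin t) : ℚ) := by
  classical
  have : Finite (P →o Fin t) := Finite.of_injective _ DFunLike.coe_injective
  have h1 : Nat.card (P →o Fin t) =
      ∑ j ∈ Finset.range (t + 1), t.choose j * surjCount P j := by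
    rw [← Nat.card_congr (Equiv.sigmaFiberEquiv
      (fun f : P →o Fin t => Finset.univ.image (f : P → Fin t)))]
    rw [Nat.card_sigma]
    simp only [card_orderHom_image_eq]
    have h2 := Finset.sum_powerset_apply_card (x := (Finset.univ : Finset (Fin t)))
      (fun j => surjCount P j)
    simpa using h2
  have h2 : ∑ j ∈ Finset.range (t + 1), t.choose j * surjCount P j =
      ∑ j ∈ Finset.range (Fintype.card P + 1), t.choose j * surjCount P j := by
    have ha : ∑ j ∈ Finset.range (t + 1), t.choose j * surjCount P j =
        ∑ j ∈ Finset.range (t + Fintype.card P + 1), t.choose j * surjCount P j := by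
      refine Finset.sum_subset (Finset.range_mono (by omega)) fun j _ hj => ?_
      rw [Nat.choose_eq_zero_of_lt (by simpa using hj), zero_mul]
    have hb : ∑ j ∈ Finset.range (Fintype.card P + 1), t.choose j * surjCount P j =
        ∑ j ∈ Finset.range (t + Fintype.card P + 1), t.choose j * surjCount P j := by
      refine Finset.sum_subset (Finset.range_mono (by omega)) fun j _ hj => ?_
      rw [surjCount_eq_zero P j (by simpa using hj), mul_zero]
    rw [ha, hb]
  rw [h1, h2, orderPolynomial, eval_finsetSum]
  push_cast
  refine Finset.sum_congr rfl fun j _ => ?_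
  rw [eval_mul, eval_C, descPochhammer_eval_eq_descFactorial,
    Nat.descFactorial_eq_factorial_mul_choose]
  push_cast
  have : (Nat.factorial j : ℚ) ≠ 0 := by exact_mod_cast Nat.factorial_ne_zero j
  field_simp

theorem orderPolynomial_unique (P : Type) [PartialOrder P] [Fintype P] (p : ℚ[X])
    (hp : ∀ t : ℕ, p.eval (t : ℚ) = (Nat.card (P →o Fin t) : ℚ)) : p = orderPolynomial P := by
  refine Polynomial.eq_of_infinite_eval_eq _ _
    ((Set.infinite_range_of_injective (Nat.cast_injective (R := ℚ))).mono ?_)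
  rintro _ ⟨t, rfl⟩
  simp only [Set.mem_ofPred_eq, hp, orderPolynomial_eval]

/-- The zigzag poset `Z_n : z_1 > z_2 < z_3 > z_4 < ⋯`; the index `i : Fin n` stands for
`z_{i+1}`, so the elements of odd index are the lower ones. -/
def Zigzag (n : ℕ) : Type := Fin n

instance (n : ℕ) : Fintype (Zigzag n) := inferInstanceAs (Fintype (Fin n))

instance (n : ℕ) : DecidableEq (Zigzag n) := inferInstanceAs (DecidableEq (Fin n))

/-- The order relation of `Z_n` on indices counted from `0`: a lower element (odd index) is
below its neighbours. -/
def zigzagLE {n : ℕ} (a b : Fin n) : Prop :=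
  a = b ∨ (Odd a.val ∧ (a.val + 1 = b.val ∨ b.val + 1 = a.val))

instance (n : ℕ) : PartialOrder (Zigzag n) where
  le a b := zigzagLE (n := n) a b
  le_refl a := Or.inl rfl
  le_trans a b c h1 h2 := by
    rcases h1 with rfl | ⟨h1, h1'⟩
    · exact h2
    · rcases h2 with rfl | ⟨h2, h2'⟩
      · exact Or.inr ⟨h1, h1'⟩
      · exfalso
        rw [Nat.odd_iff] at h1 h2
        omega
  le_antisymm a b h1 h2 := by
    rcases h1 with rfl | ⟨h1, h1'⟩
    · rfl
    · rcases h2 with h2 | ⟨h2, h2'⟩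
      · exact h2.symm
      · exfalso
        rw [Nat.odd_iff] at h1 h2
        omega

/-- The Euler number `E_n`, the number of linear extensions of `Z_n`. -/
def eulerE (n : ℕ) : ℕ := numLinearExtensions (Zigzag n)

/-- The crown poset `C_{2n}`: the zigzag `Z_{2n}` with the additional relation `z_{2n} < z_1`
(on indices counted from `0`: `2n - 1` is below `0`). -/
def Crown (n : ℕ) : Type := Fin (2 * n)

instance (n : ℕ) : Fintype (Crown n) := inferInstanceAs (Fintype (Fin (2 * n)))

instance (n : ℕ) : DecidableEq (Crown n) := inferInstanceAs (DecidableEq (Fin (2 * n)))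

/-- The order relation of `C_{2n}`. -/
def crownLE {n : ℕ} (a b : Fin (2 * n)) : Prop :=
  zigzagLE a b ∨ (a.val + 1 = 2 * n ∧ b.val = 0)

instance (n : ℕ) : PartialOrder (Crown n) where
  le a b := crownLE (n := n) a b
  le_refl a := Or.inl (Or.inl rfl)
  le_trans a b c h1 h2 := by
    replace h1 : crownLE (n := n) a b := h1
    replace h2 : crownLE (n := n) b c := h2
    unfold crownLE zigzagLE at *
    simp only [Nat.odd_iff] at *
    omega
  le_antisymm a b h1 h2 := by
    replace h1 : crownLE (n := n) a b := h1
    replace h2 : crownLE (n := n) b a := h2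
    refine Fin.ext (n := 2 * n) ?_
    unfold crownLE zigzagLE at *
    simp only [Nat.odd_iff] at *
    omega

/-- `s` is (the ground set of) a convex subposet of `P`: it is connected (in particular
non-empty) for the comparability relation restricted to `s`, and it contains every element of
`P` that lies between two of its elements. -/
def IsConvexSubposet {P : Type} [PartialOrder P] (s : Finset P) : Prop :=
  (SimpleGraph.fromRel fun a b : s => a ≤ b).Connected ∧ (s : Set P).OrdConnected

/-- The relation on blocks: some element of `s` is below some element of `s'`. -/
def BlockLE {P : Type} [PartialOrder P] (s s' : Finset P) : Prop :=
  ∃ a ∈ s, ∃ b ∈ s', a ≤ b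

/-- `μ` is a standard decomposition: a partition of `P` into convex subposets such that there are
no `r ≥ 2` distinct blocks `P_1, …, P_r` with `P_1 ≤ P_2 ≤ ⋯ ≤ P_r ≤ P_1` for the relation
`BlockLE` (`finRotate r` is the cyclic successor on `Fin r`). -/
def IsStandardDecomposition {P : Type} [PartialOrder P] [Fintype P] [DecidableEq P]
    (μ : Finpartition (Finset.univ : Finset P)) : Prop :=
  (∀ s ∈ μ.parts, IsConvexSubposet s) ∧
    ¬ ∃ (r : ℕ) (p : Fin r → Finset P), 2 ≤ r ∧ Function.Injective p ∧
      (∀ i, p i ∈ μ.parts) ∧ ∀ i, BlockLE (p i) (p (finRotate r i))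

open Classical in
/-- `SDecompo_k(P)`: the standard decompositions of `P` into `k` convex subposets. -/
def SDecompo (P : Type) [PartialOrder P] [Fintype P] [DecidableEq P] (k : ℕ) :
    Finset (Finpartition (Finset.univ : Finset P)) :=
  Finset.univ.filter fun μ => IsStandardDecomposition μ ∧ μ.parts.card = k

/-- `w₊(2k+1) = (k!)² / (2k+1)!`, as a function of `k`. -/
def wPlus (k : ℕ) : ℚ :=
  (Nat.factorial k : ℚ) ^ 2 / (Nat.factorial (2 * k + 1) : ℚ)

/-- `w₋(2k+1)`, as a function of `k`: it is `1` for `k = 0` and `-(k!)² / (2k · (2k+1)!)` for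
`k ≥ 1`. -/
def wMinus (k : ℕ) : ℚ :=
  if k = 0 then 1
  else -((Nat.factorial k : ℚ) ^ 2) / (2 * (k : ℚ) * (Nat.factorial (2 * k + 1) : ℚ))

open Classical in
/-- The weight `ŵ` of a block `s`: `0` if `|s|` is even; if `|s| = 2k+1`, it is `w₋(2k+1)` if `s`
has more upper (maximal in `P`) than lower (minimal in `P`) elements, and `w₊(2k+1)` otherwise.
No block is treated as special. -/
def blockWeight {P : Type} [PartialOrder P] (s : Finset P) : ℚ :=
  if Even s.card then 0
  else if (s.filter fun a => IsMin a).card < (s.filter fun a => IsMax a).card then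
    wMinus (s.card / 2)
  else wPlus (s.card / 2)

/-- The weight `ŵ(μ)` of a decomposition: the product of the weights of its blocks. -/
def decompositionWeight {P : Type} [PartialOrder P] [Fintype P] [DecidableEq P]
    (μ : Finpartition (Finset.univ : Finset P)) : ℚ :=
  ∏ s ∈ μ.parts, blockWeight s

/-- The normalized coefficient `f̂_{2n,k} = (2n)! · [t^k] Ω(C_{2n}; t - 1/2)`. -/
def fHat (n k : ℕ) : ℚ :=
  (Nat.factorial (2 * n) : ℚ) * ((orderPolynomial (Crown n)).comp (X - C (1 / 2))).coeff k

end

/-! Both sides are governed by one series, `A(z) = 4 arcsin²(√z/2) = z·W₊(z)·W₋(z)`, where `W₊` and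
`W₋` are the generating functions of the two weights (`arcsinSq_eq`).

Order polynomial. Order-preserving maps from the crown to an `s`-chain are closed walks, counted by
`tr (T Tᵀ)^n` for a triangular 0-1 matrix `T` (`card_crown_orderHom`). These traces form minus the
logarithmic derivative of `det (1 - z T Tᵀ)`, a tridiagonal determinant equal to `cos((2s+1)θ) / cos
θ` with `sin θ = √z/2` (`tridiag_mul_cosArcsin`). Hence `Ω(C_{2n}; t - 1/2) = n [z^n] (-log cos 2tθ
+ log cos θ)`. Since `(2tθ)² = t² A`, the odd coefficients vanish and the coefficient of `t^{2m}`,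
`m ≥ 1`, is `n c_m [z^n] A^m`, where `-log cos √u = ∑ c_m u^m`. For `m = n` this is the leading
coefficient `e(C_{2n}) / (2n)!`. Removing the top of a linear extension gives `e(C_{2n}) = n
E_{2n-1}`, so `c_m = E_{2m-1} / (2m)!` (`coeff_logSecSqrt_eq`).

Decompositions. Only those into odd arcs have non-zero weight, which forces `k = 2m`. Around the
cycle such arcs alternate between lower and upper majority, and the acyclicity condition is
automatic. The decompositions with an arc starting at a given element `p` are compositions into odd
parts with alternating weights, of total weight `[z^n] A^m`. There are `2n` choices of `p`, and each
decomposition has `2m` starts, so `2m ∑ ŵ(μ) = 2n [z^n] A^m` (`sum_decompositionWeight_even`). -/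

/-! ### Generating functions of the block weights. -/

/-- The power series `∑ w₊(2j+1) z^j`. -/
noncomputable def wPlusSeries : PowerSeries ℚ := PowerSeries.mk wPlus

/-- The power series `∑ w₋(2j+1) z^j`. -/
noncomputable def wMinusSeries : PowerSeries ℚ := PowerSeries.mk wMinus

/-- The expansion of `4 arcsin² (√z / 2)`. -/
noncomputable def arcsinSq : PowerSeries ℚ :=
  PowerSeries.X * (1 - PowerSeries.C (1 / 4) * PowerSeries.X) * wPlusSeries ^ 2

theorem wPlus_succ (j : ℕ) : (2 * j + 3 : ℚ) * wPlus (j + 1) = (j + 1) / 2 * wPlus j := by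
  have h1 : (Nat.factorial (2 * j + 1) : ℚ) ≠ 0 := by exact_mod_cast Nat.factorial_ne_zero _
  have h2 : (2 * j + 3 : ℚ) ≠ 0 := by positivity
  have h3 : (j + 1 : ℚ) ≠ 0 := by positivity
  have h4 : (Nat.factorial (2 * (j + 1) + 1) : ℚ)
      = (2 * j + 3) * (2 * (j + 1)) * Nat.factorial (2 * j + 1) := by
    rw [show 2 * (j + 1) + 1 = (2 * j + 1) + 1 + 1 by ring, Nat.factorial_succ, Nat.factorial_succ]
    push_cast; ring
  have h5 : (Nat.factorial (j + 1) : ℚ) = (j + 1) * Nat.factorial j := by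
    rw [Nat.factorial_succ]; push_cast; ring
  rw [wPlus, wPlus, h4, h5]
  field_simp

theorem wMinus_succ (j : ℕ) : wMinus (j + 1) = wPlus (j + 1) - 1 / 4 * wPlus j := by
  have h := wPlus_succ j
  have h3 : (j + 1 : ℚ) ≠ 0 := by positivity
  have h4 : wMinus (j + 1) = -wPlus (j + 1) / (2 * (j + 1)) := by
    rw [wMinus, if_neg (Nat.succ_ne_zero j), wPlus]
    push_cast
    field_simp
  have h5 : wPlus j = (2 * j + 3 : ℚ) * wPlus (j + 1) * 2 / (j + 1) := by
    rw [h]; field_simp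
  rw [h4, h5]
  field_simp
  ring

theorem wMinusSeries_eq :
    wMinusSeries = (1 - PowerSeries.C (1 / 4) * PowerSeries.X) * wPlusSeries := by
  ext n
  rw [sub_mul, one_mul, mul_assoc, map_sub, PowerSeries.coeff_C_mul]
  cases n with
  | zero => simp [wMinusSeries, wPlusSeries, wMinus, wPlus]
  | succ j =>
    rw [PowerSeries.coeff_succ_X_mul]
    simp only [wMinusSeries, wPlusSeries, PowerSeries.coeff_mk, wMinus_succ]

theorem arcsinSq_eq : arcsinSq = PowerSeries.X * (wPlusSeries * wMinusSeries) := by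
  rw [wMinusSeries_eq, arcsinSq]; ring

/-- This is `wPlus_succ` in generating-function form: the coefficient of `z^n` reads `(4n + 2) w_n =
n w_{n-1}` for `n ≥ 1`. -/
theorem wPlusSeries_ode :
    (2 - PowerSeries.X) * wPlusSeries + (4 * PowerSeries.X - PowerSeries.X ^ 2) *
      PowerSeries.derivative ℚ wPlusSeries = 2 := by
  have h2 : (2 : PowerSeries ℚ) = PowerSeries.C 2 := rfl
  have h4 : (4 : PowerSeries ℚ) = PowerSeries.C 4 := rfl
  -- Every product is now by a constant or by a single `X`, so coefficients can be read off
  -- directly.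
  have key : PowerSeries.C 2 * wPlusSeries - PowerSeries.X * wPlusSeries +
      (PowerSeries.C 4 * (PowerSeries.X * PowerSeries.derivative ℚ wPlusSeries) -
        PowerSeries.X * (PowerSeries.X * PowerSeries.derivative ℚ wPlusSeries)) =
        PowerSeries.C 2 := by
    ext n
    rcases n with _ | _ | n
    · simp [wPlusSeries, wPlus]
    · have := wPlus_succ 0
      simp [wPlusSeries, PowerSeries.coeff_succ_X_mul, PowerSeries.coeff_derivative]
        at this ⊢
      linarith
    · have := wPlus_succ (n + 1)
      simp [wPlusSeries, PowerSeries.coeff_succ_X_mul, PowerSeries.coeff_derivative]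
        at this ⊢
      linarith
  rw [← h2, ← h4] at key
  linear_combination key

/-- Since `4A = (4z - z²) W₊²`, the product rule makes `4A'` equal to `2 W₊` times the left side of
`wPlusSeries_ode`. -/
theorem derivative_arcsinSq : PowerSeries.derivative ℚ arcsinSq = wPlusSeries := by
  have h := wPlusSeries_ode
  have h4 : (4 : PowerSeries ℚ) * PowerSeries.C (1 / 4) = 1 := by
    rw [show (4 : PowerSeries ℚ) = PowerSeries.C 4 from rfl, ← map_mul]; norm_num
  have hne : (4 : PowerSeries ℚ) ≠ 0 := by
    intro h0; rw [h0, zero_mul] at h4; exact zero_ne_one h4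
  apply mul_left_cancel₀ hne
  rw [arcsinSq]
  simp only [Derivation.leibniz, smul_eq_mul, map_sub, PowerSeries.derivative_X,
    PowerSeries.derivative_C, PowerSeries.derivative_pow, PowerSeries.derivative_one]
  push_cast
  linear_combination (2 * wPlusSeries) * h + (-2 * PowerSeries.X * wPlusSeries ^ 2 -
    2 * PowerSeries.X ^ 2 * wPlusSeries * PowerSeries.derivative ℚ wPlusSeries) * h4

theorem constantCoeff_arcsinSq : PowerSeries.constantCoeff arcsinSq = 0 := by
  simp [arcsinSq]

/-! ### The series of `cos √u` and `-log cos √u`. -/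

/-- The expansion of `cos √u`. -/
noncomputable def cosSqrt : PowerSeries ℚ :=
  PowerSeries.mk fun j => (-1) ^ j / (Nat.factorial (2 * j) : ℚ)

theorem cosSqrt_ode : 4 * PowerSeries.X * PowerSeries.derivative ℚ
    (PowerSeries.derivative ℚ cosSqrt) + 2 * PowerSeries.derivative ℚ cosSqrt + cosSqrt = 0 := by
  have h2 : (2 : PowerSeries ℚ) = PowerSeries.C 2 := rfl
  have h4 : (4 : PowerSeries ℚ) = PowerSeries.C 4 := rfl
  have hf : ∀ j : ℕ, (Nat.factorial (2 * (j + 1)) : ℚ)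
      = (2 * j + 2) * (2 * j + 1) * Nat.factorial (2 * j) := fun j => by
    rw [show 2 * (j + 1) = (2 * j) + 1 + 1 by ring, Nat.factorial_succ, Nat.factorial_succ]
    push_cast; ring
  have h0 : ∀ j : ℕ, (Nat.factorial j : ℚ) ≠ 0 := fun j => by
    exact_mod_cast Nat.factorial_ne_zero _
  rw [h2, h4, mul_assoc]
  ext n
  rcases n with _ | n
  · rw [map_add, map_add, PowerSeries.coeff_C_mul, PowerSeries.coeff_C_mul,
      PowerSeries.coeff_derivative]
    norm_num [cosSqrt]
  · simp [cosSqrt, PowerSeries.coeff_succ_X_mul, PowerSeries.coeff_derivative, hf]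
    have h1 := h0 (2 * n)
    have h3 : (2 * (n:ℚ) + 1) ≠ 0 := by positivity
    have h5 : (2 * (n + 1 : ℚ) + 1) ≠ 0 := by positivity
    have h6 : (2 * (n:ℚ) + 2) ≠ 0 := by positivity
    have h7 : (2 * ((n:ℚ) + 1) + 2) ≠ 0 := by positivity
    field_simp
    ring

theorem constantCoeff_cosSqrt : PowerSeries.constantCoeff cosSqrt = 1 := by
  simp [cosSqrt]

/-- The expansion of `-log cos √u`. -/
noncomputable def logSecSqrt : PowerSeries ℚ :=
  PowerSeries.mk fun m =>
    PowerSeries.coeff (m - 1) (-PowerSeries.derivative ℚ cosSqrt * cosSqrt⁻¹) / (m : ℚ)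

/-- `logSecSqrt` is a termwise antiderivative; its constant term is a quotient by `0`, hence `0`. -/
theorem derivative_logSecSqrt :
    PowerSeries.derivative ℚ logSecSqrt * cosSqrt = -PowerSeries.derivative ℚ cosSqrt := by
  have h : PowerSeries.derivative ℚ logSecSqrt =
      -PowerSeries.derivative ℚ cosSqrt * cosSqrt⁻¹ := by
    ext n
    rw [PowerSeries.coeff_derivative, logSecSqrt, PowerSeries.coeff_mk]
    have : ((n + 1 : ℕ) : ℚ) ≠ 0 := by positivity
    rw [Nat.add_sub_cancel]
    push_cast at this ⊢
    field_simp
  rw [h, mul_assoc, PowerSeries.inv_mul_cancel, mul_one]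
  rw [constantCoeff_cosSqrt]; exact one_ne_zero

/-! ### Substitution of `t² A`: the series of `cos 2tθ` with `sin θ = √z/2`. -/

theorem hasSubst_mul_arcsinSq (t : ℚ) :
    PowerSeries.HasSubst (PowerSeries.C (t ^ 2) * arcsinSq) :=
  PowerSeries.HasSubst.of_constantCoeff_zero' (by simp [constantCoeff_arcsinSq])

/-- The expansion of `cos (2 t arcsin (√z / 2))`. -/
noncomputable def cosArcsin (t : ℚ) : PowerSeries ℚ :=
  cosSqrt.subst (PowerSeries.C (t ^ 2) * arcsinSq)

/-- The expansion of `-log cos (2 t arcsin (√z / 2))`. -/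
noncomputable def logSecArcsin (t : ℚ) : PowerSeries ℚ :=
  logSecSqrt.subst (PowerSeries.C (t ^ 2) * arcsinSq)

theorem derivative_mul_arcsinSq (t : ℚ) :
    PowerSeries.derivative ℚ (PowerSeries.C (t ^ 2) * arcsinSq) =
      PowerSeries.C (t ^ 2) * wPlusSeries := by
  rw [Derivation.leibniz, derivative_arcsinSq, PowerSeries.derivative_C]
  simp

theorem derivative_logSecArcsin (t : ℚ) :
    PowerSeries.derivative ℚ (logSecArcsin t) * cosArcsin t =
      -PowerSeries.derivative ℚ (cosArcsin t) := by
  have hs := hasSubst_mul_arcsinSq t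
  have h := congrArg (PowerSeries.substAlgHom (R := ℚ) hs) derivative_logSecSqrt
  rw [map_mul, map_neg] at h
  simp only [PowerSeries.coe_substAlgHom] at h
  rw [logSecArcsin, cosArcsin, PowerSeries.derivative_subst hs, PowerSeries.derivative_subst hs]
  linear_combination (PowerSeries.derivative ℚ (PowerSeries.C (t ^ 2) * arcsinSq)) * h

/-- By the chain rule with `A' = W₊`, the identities `wPlusSeries_ode` and `(4z - z²) W₊² = 4A`
reduce this to `t²` times `cosSqrt_ode` evaluated at `t² A`. -/
theorem cosArcsin_ode (t : ℚ) :
    (4 * PowerSeries.X - PowerSeries.X ^ 2) *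
      PowerSeries.derivative ℚ (PowerSeries.derivative ℚ (cosArcsin t)) +
      (2 - PowerSeries.X) * PowerSeries.derivative ℚ (cosArcsin t) +
      PowerSeries.C (t ^ 2) * cosArcsin t = 0 := by
  have hs := hasSubst_mul_arcsinSq t
  have h := congrArg (PowerSeries.substAlgHom (R := ℚ) hs) cosSqrt_ode
  simp only [map_add, map_mul, map_ofNat, map_zero] at h
  simp only [PowerSeries.coe_substAlgHom, PowerSeries.subst_X hs] at h
  rw [cosArcsin, PowerSeries.derivative_subst hs, derivative_mul_arcsinSq, Derivation.leibniz,
    Derivation.leibniz, PowerSeries.derivative_subst hs, derivative_mul_arcsinSq,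
    PowerSeries.derivative_C]
  simp only [smul_eq_mul]
  have h4 : (4 : PowerSeries ℚ) * PowerSeries.C (1 / 4) = 1 := by
    rw [show (4 : PowerSeries ℚ) = PowerSeries.C 4 from rfl, ← map_mul]; norm_num
  have ho := wPlusSeries_ode
  rw [arcsinSq] at *
  set c := PowerSeries.subst (PowerSeries.C (t ^ 2) * (PowerSeries.X *
    (1 - PowerSeries.C (1 / 4) * PowerSeries.X) * wPlusSeries ^ 2)) cosSqrt
  set c1 := PowerSeries.subst (PowerSeries.C (t ^ 2) * (PowerSeries.X *
    (1 - PowerSeries.C (1 / 4) * PowerSeries.X) * wPlusSeries ^ 2))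
    (PowerSeries.derivative ℚ cosSqrt)
  set c2 := PowerSeries.subst (PowerSeries.C (t ^ 2) * (PowerSeries.X *
    (1 - PowerSeries.C (1 / 4) * PowerSeries.X) * wPlusSeries ^ 2))
    (PowerSeries.derivative ℚ (PowerSeries.derivative ℚ cosSqrt))
  linear_combination (PowerSeries.C (t ^ 2)) * h + (PowerSeries.C (t ^ 2)) * c1 * ho +
    PowerSeries.C (t ^ 2) ^ 2 * c2 * PowerSeries.X ^ 2 * wPlusSeries ^ 2 * h4

theorem coeff_cosArcsin_succ (t : ℚ) (n : ℕ) :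
    (2 * n + 2) * (2 * n + 1) * PowerSeries.coeff (n + 1) (cosArcsin t) =
      (n ^ 2 - t ^ 2) * PowerSeries.coeff n (cosArcsin t) := by
  have h2 : (2 : PowerSeries ℚ) = PowerSeries.C 2 := rfl
  have h4 : (4 : PowerSeries ℚ) = PowerSeries.C 4 := rfl
  have h := cosArcsin_ode t
  set f := cosArcsin t
  have key : PowerSeries.C 4 * (PowerSeries.X *
        PowerSeries.derivative ℚ (PowerSeries.derivative ℚ f)) -
      PowerSeries.X * (PowerSeries.X * PowerSeries.derivative ℚ (PowerSeries.derivative ℚ f)) +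
      (PowerSeries.C 2 * PowerSeries.derivative ℚ f -
        PowerSeries.X * PowerSeries.derivative ℚ f) + PowerSeries.C (t ^ 2) * f = 0 := by
    rw [← h2, ← h4]; linear_combination h
  have hn := congrArg (PowerSeries.coeff n) key
  rcases n with _ | _ | n <;>
  · simp [PowerSeries.coeff_succ_X_mul, PowerSeries.coeff_derivative, -map_pow,
      PowerSeries.coeff_zero_X_mul, -PowerSeries.coeff_zero_eq_constantCoeff] at hn ⊢
    linarith

/-- `A` is divisible by `z`. This makes each coefficient of a series in `t² A` a polynomial in `t`.
-/
theorem coeff_arcsinSq_pow_of_lt {n j : ℕ} (h : n < j) :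
    PowerSeries.coeff n (arcsinSq ^ j) = 0 := by
  refine PowerSeries.X_pow_dvd_iff.1 (pow_dvd_pow_of_dvd ?_ j) n h
  exact ⟨_, arcsinSq_eq⟩

theorem coeff_subst_mul_arcsinSq (f : PowerSeries ℚ) (t : ℚ) (n : ℕ) :
    PowerSeries.coeff n (f.subst (PowerSeries.C (t ^ 2) * arcsinSq)) =
      ∑ j ∈ Finset.range (n + 1), PowerSeries.coeff j f *
        PowerSeries.coeff n (arcsinSq ^ j) * t ^ (2 * j) := by
  rw [PowerSeries.coeff_subst' (hasSubst_mul_arcsinSq t)]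
  rw [finsum_eq_sum_of_support_subset (s := Finset.range (n + 1))]
  · refine Finset.sum_congr rfl fun j _ => ?_
    rw [mul_pow, ← map_pow, PowerSeries.coeff_C_mul, smul_eq_mul, ← pow_mul]
    ring
  · intro j hj
    by_contra hj'
    refine hj ?_
    change PowerSeries.coeff j f • PowerSeries.coeff n ((PowerSeries.C (t ^ 2) * arcsinSq) ^ j) = 0
    rw [mul_pow, ← map_pow, PowerSeries.coeff_C_mul, coeff_arcsinSq_pow_of_lt, mul_zero, smul_zero]
    rw [Finset.mem_coe, Finset.mem_range] at hj'
    omega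

theorem coeff_zero_cosArcsin (t : ℚ) : PowerSeries.coeff 0 (cosArcsin t) = 1 := by
  rw [cosArcsin, coeff_subst_mul_arcsinSq]
  simp [cosSqrt]

theorem coeff_cosArcsin (t : ℚ) (n : ℕ) :
    PowerSeries.coeff n (cosArcsin t) =
      (∏ i ∈ Finset.range n, ((i : ℚ) ^ 2 - t ^ 2)) / Nat.factorial (2 * n) := by
  induction n with
  | zero => simpa using coeff_zero_cosArcsin t
  | succ n ih =>
    have h := coeff_cosArcsin_succ t n
    have hf : (Nat.factorial (2 * (n + 1)) : ℚ)
        = (2 * n + 2) * (2 * n + 1) * Nat.factorial (2 * n) := by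
      rw [show 2 * (n + 1) = (2 * n) + 1 + 1 by ring, Nat.factorial_succ, Nat.factorial_succ]
      push_cast; ring
    have h0 : (Nat.factorial (2 * n) : ℚ) ≠ 0 := by exact_mod_cast Nat.factorial_ne_zero _
    have h3 : (2 * (n:ℚ) + 1) ≠ 0 := by positivity
    have h6 : (2 * (n:ℚ) + 2) ≠ 0 := by positivity
    rw [ih] at h
    rw [Finset.prod_range_succ, hf]
    field_simp at h ⊢
    linarith

/-- Split each factor into `i - (t+1)` and `i + (t+1)`: shifting `t` by one moves both strings of
consecutive factors, leaving a common core and four boundary factors. At `t` and `-t` it gives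
`cosArcsin (t + 1)` and `cosArcsin (t - 1)` the same core. -/
theorem prod_central_aux (t : ℚ) (n : ℕ) :
    ∏ i ∈ Finset.range (n + 2), ((i : ℚ) ^ 2 - (t + 1) ^ 2) =
      (t + 1) * (t + n + 1) * (t + n + 2) * t *
        ∏ i ∈ Finset.range n, ((i + 1 : ℚ) ^ 2 - t ^ 2) := by
  induction n with
  | zero => simp [Finset.prod_range_succ]; ring
  | succ n ih =>
    rw [Finset.prod_range_succ, ih, Finset.prod_range_succ]
    push_cast
    ring

/-- This is `cos(2t+2)θ + cos(2t-2)θ = 2 cos 2θ cos 2tθ` with `2 cos 2θ = 2 - 4 sin²θ = 2 - z`,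
checked on the explicit coefficients. -/
theorem cosArcsin_recurrence (t : ℚ) :
    cosArcsin (t + 1) + cosArcsin (t - 1) = (2 - PowerSeries.X) * cosArcsin t := by
  have h2 : (2 : PowerSeries ℚ) = PowerSeries.C 2 := rfl
  rw [sub_mul, h2]
  ext n
  rcases n with _ | n
  · simp [coeff_zero_cosArcsin, - PowerSeries.coeff_zero_eq_constantCoeff]
    norm_num
  · rw [map_add, map_sub, PowerSeries.coeff_C_mul, PowerSeries.coeff_succ_X_mul]
    simp only [coeff_cosArcsin]
    have hf : (Nat.factorial (2 * (n + 1)) : ℚ)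
        = (2 * n + 2) * (2 * n + 1) * Nat.factorial (2 * n) := by
      rw [show 2 * (n + 1) = (2 * n) + 1 + 1 by ring, Nat.factorial_succ, Nat.factorial_succ]
      push_cast; ring
    have h0 : (Nat.factorial (2 * n) : ℚ) ≠ 0 := by exact_mod_cast Nat.factorial_ne_zero _
    have h3 : (2 * (n:ℚ) + 1) ≠ 0 := by positivity
    have h6 : (2 * (n:ℚ) + 2) ≠ 0 := by positivity
    rw [hf]
    rcases n with _ | n
    · simp; ring
    · have ha := prod_central_aux t n
      have hb := prod_central_aux (-t) n
      have hc : ∀ i : ℕ, ((i : ℚ) ^ 2 - (-t + 1) ^ 2) = (i : ℚ) ^ 2 - (t - 1) ^ 2 := fun i => by ring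
      simp only [hc, neg_sq] at hb
      have hd : ∀ n : ℕ, ∏ i ∈ Finset.range (n + 1), ((i : ℚ) ^ 2 - t ^ 2) =
          -t ^ 2 * ∏ i ∈ Finset.range n, ((i + 1 : ℚ) ^ 2 - t ^ 2) := fun n => by
        rw [Finset.prod_range_succ']; push_cast; ring
      rw [ha, hb, hd, hd, Finset.prod_range_succ]
      generalize ∏ i ∈ Finset.range n, ((i + 1 : ℚ) ^ 2 - t ^ 2) = q
      push_cast at *
      field_simp
      ring

theorem cosArcsin_neg (t : ℚ) : cosArcsin (-t) = cosArcsin t := by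
  rw [cosArcsin, cosArcsin, neg_sq]

/-! ### Logarithmic derivative of a characteristic determinant. -/

theorem coeff_X_mul_derivative {R : Type*} [CommSemiring R] (f : PowerSeries R) (n : ℕ) :
    PowerSeries.coeff n (PowerSeries.X * PowerSeries.derivative R f) =
      n * PowerSeries.coeff n f := by
  cases n with
  | zero => simp [PowerSeries.coeff_zero_X_mul]
  | succ n =>
    rw [PowerSeries.coeff_succ_X_mul, PowerSeries.coeff_derivative]
    push_cast; ring

theorem Derivation.leibniz_finset_prod {R S ι : Type*} [CommRing R] [CommRing S] [Algebra R S]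
    [DecidableEq ι] (D : Derivation R S S) (s : Finset ι) (f : ι → S) :
    D (∏ i ∈ s, f i) = ∑ i ∈ s, (∏ j ∈ s.erase i, f j) * D (f i) := by
  induction s using Finset.induction_on with
  | empty => simp
  | insert a s ha ih =>
    rw [Finset.prod_insert ha, Derivation.leibniz, ih, Finset.sum_insert ha,
      Finset.erase_insert ha, smul_eq_mul, smul_eq_mul, Finset.mul_sum, add_comm]
    congr 1
    refine Finset.sum_congr rfl fun i hi => ?_
    have hai : a ≠ i := fun h => ha (h ▸ hi)
    rw [Finset.erase_insert_of_ne hai, Finset.prod_insert, mul_assoc]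
    exact fun h => ha (Finset.mem_of_mem_erase h)

/-- Jacobi's formula for the derivative of a determinant. -/
theorem Derivation.map_det {R S ι : Type*} [CommRing R] [CommRing S] [Algebra R S]
    [Fintype ι] [DecidableEq ι] (D : Derivation R S S) (A : Matrix ι ι S) :
    D A.det = (A.adjugate * A.map D).trace := by
  -- By Cramer's rule the trace is the sum of the determinants with one column differentiated, which
  -- is the Leibniz rule applied to the permutation expansion.
  have h : ∀ i, (A.adjugate * A.map D) i i = (A.updateCol i fun j => D (A j i)).det := by
    intro i
    rw [← Matrix.cramer_apply, Matrix.cramer_eq_adjugate_mulVec]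
    rfl
  simp only [Matrix.trace, Matrix.diag, h, Matrix.det_apply]
  rw [_root_.map_sum, Finset.sum_comm]
  refine Finset.sum_congr rfl fun σ _ => ?_
  rw [← Finset.smul_sum, map_zsmul_unit, Derivation.leibniz_finset_prod]
  congr 1
  refine Finset.sum_congr rfl fun i _ => ?_
  rw [← Finset.prod_erase_mul _ _ (Finset.mem_univ i)]
  congr 1
  · refine Finset.prod_congr rfl fun j hj => ?_
    rw [Matrix.updateCol_ne (Finset.ne_of_mem_erase hj)]
  · simp

/-- The characteristic series `det (1 - z M)`. -/
noncomputable def detOneSub {ι : Type*} [Fintype ι] [DecidableEq ι] (M : Matrix ι ι ℚ) :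
    PowerSeries ℚ :=
  (1 - (PowerSeries.X : PowerSeries ℚ) • M.map (PowerSeries.C (R := ℚ))).det

/-- The logarithmic derivative of `det (1 - z M)` is the generating function of the traces of the
powers of `M`. -/
theorem derivative_detOneSub {ι : Type*} [Fintype ι] [DecidableEq ι] (M : Matrix ι ι ℚ) :
    PowerSeries.derivative ℚ (detOneSub M) =
      -(detOneSub M * PowerSeries.mk fun n => (M ^ (n + 1)).trace) := by
  set A : Matrix ι ι (PowerSeries ℚ) :=
    1 - (PowerSeries.X : PowerSeries ℚ) • M.map (PowerSeries.C (R := ℚ)) with hA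
  -- `G` is the geometric series `∑ zⁿ Mⁿ`, the inverse of `1 - z M`, so the adjugate is the
  -- determinant times `G`.
  set G : Matrix ι ι (PowerSeries ℚ) := Matrix.of fun i j => PowerSeries.mk fun n => (M ^ n) i j
    with hG
  have hMG : ∀ i j, (M.map (PowerSeries.C (R := ℚ)) * G) i j =
      PowerSeries.mk fun n => (M ^ (n + 1)) i j := by
    intro i j
    ext n
    rw [Matrix.mul_apply, map_sum, PowerSeries.coeff_mk, pow_succ', Matrix.mul_apply]
    refine Finset.sum_congr rfl fun l _ => ?_
    simp [hG]
  have hAG : A * G = 1 := by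
    rw [hA, sub_mul, one_mul, Matrix.smul_mul]
    ext i j n
    rw [Matrix.sub_apply, Matrix.smul_apply, hMG, smul_eq_mul, map_sub]
    cases n with
    | zero =>
      rw [PowerSeries.coeff_zero_X_mul, sub_zero]
      by_cases hij : i = j <;> simp [hG, hij, Matrix.one_apply]
    | succ n =>
      rw [PowerSeries.coeff_succ_X_mul, PowerSeries.coeff_mk, hG, Matrix.of_apply,
        PowerSeries.coeff_mk, sub_self]
      by_cases hij : i = j <;> simp [hij, Matrix.one_apply, PowerSeries.coeff_one]
  have hadj : A.adjugate = A.det • G := by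
    calc A.adjugate = A.adjugate * (A * G) := by rw [hAG, mul_one]
      _ = A.det • G := by rw [← mul_assoc, Matrix.adjugate_mul, Matrix.smul_mul, one_mul]
  have hmap : A.map (PowerSeries.derivative ℚ) = -M.map (PowerSeries.C (R := ℚ)) := by
    ext1 i j
    rw [Matrix.map_apply, hA, Matrix.sub_apply, Matrix.smul_apply, map_sub, Matrix.map_apply,
      smul_eq_mul, Derivation.leibniz, PowerSeries.derivative_C]
    by_cases hij : i = j <;> simp [hij, Matrix.one_apply]
  have hdet : detOneSub M = A.det := rfl
  rw [hdet, Derivation.map_det, hmap, hadj, Matrix.mul_neg, Matrix.trace_neg, Matrix.smul_mul,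
    Matrix.trace_smul, Matrix.trace_mul_comm, smul_eq_mul]
  congr 2
  ext n
  rw [Matrix.trace, map_sum, PowerSeries.coeff_mk, Matrix.trace]
  refine Finset.sum_congr rfl fun i _ => ?_
  simp only [Matrix.diag, hMG, PowerSeries.coeff_mk]

/-! ### The transfer matrix and its tridiagonal determinant. -/

/-- The transfer matrix from an upper element to a lower one. -/
def stepMatrix (s : ℕ) : Matrix (Fin s) (Fin s) ℚ := Matrix.of fun a b => if b ≤ a then 1 else 0

/-- The inverse of `stepMatrix s`. -/
def stepMatrixInv (s : ℕ) : Matrix (Fin s) (Fin s) ℚ :=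
  Matrix.of fun a b => if a = b then 1 else if b.val + 1 = a.val then -1 else 0

theorem det_stepMatrixInv (s : ℕ) : (stepMatrixInv s).det = 1 := by
  rw [Matrix.det_of_isLowerTriangular]
  · simp [stepMatrixInv]
  · intro i j hij
    have : i < j := hij
    rw [Fin.lt_def] at this
    simp only [stepMatrixInv, Matrix.of_apply]
    rw [if_neg (by rintro rfl; omega), if_neg (by omega)]

theorem Fin.sum_ite_eq_val {R : Type*} [AddCommMonoid R] (s m : ℕ) (x : R) :
    ∑ i : Fin s, (if m = i.val then x else 0) = if m < s then x else 0 := by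
  split_ifs with h
  · rw [Finset.sum_eq_single (⟨m, h⟩ : Fin s)]
    · simp
    · intro c _ hc
      rw [if_neg]
      intro h; exact hc (Fin.ext h.symm)
    · simp
  · refine Finset.sum_eq_zero fun c _ => if_neg ?_
    have := c.2
    omega

/-- Partial summation is inverted by taking differences. -/
theorem stepMatrixInv_mul (s : ℕ) : stepMatrix s * stepMatrixInv s = 1 := by
  ext a b
  rw [Matrix.mul_apply, Matrix.one_apply]
  have : ∀ c : Fin s, stepMatrix s a c * stepMatrixInv s c b =
      (if c = b then (if b ≤ a then 1 else 0) else 0) -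
        (if b.val + 1 = c.val then (if b.val + 1 ≤ a.val then 1 else 0) else 0) := by
    intro c
    simp only [stepMatrix, stepMatrixInv, Matrix.of_apply, Fin.le_def, Fin.ext_iff]
    split_ifs <;> first | omega | simp
  simp only [this, Finset.sum_sub_distrib, Finset.sum_ite_eq', Finset.mem_univ, if_true]
  rw [Fin.sum_ite_eq_val]
  have := a.2
  have := b.2
  simp only [Fin.le_def, Fin.ext_iff]
  split_ifs <;> first | omega | simp

/-- The tridiagonal matrix with diagonal `2 - z, …, 2 - z, 1 - z` and off-diagonal entries `-1`. -/
noncomputable def tridiag (s : ℕ) : Matrix (Fin s) (Fin s) (PowerSeries ℚ) :=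
  Matrix.of fun a b => if a = b then (if a.val + 1 = s then 1 else 2) - PowerSeries.X
    else if a.val + 1 = b.val ∨ b.val + 1 = a.val then -1 else 0

theorem det_tridiag_recurrence (s : ℕ) :
    (tridiag (s + 2)).det = (2 - PowerSeries.X) * (tridiag (s + 1)).det - (tridiag s).det := by
  have h1 : (tridiag (s + 2)).submatrix Fin.succ Fin.succ = tridiag (s + 1) := by
    ext1 a b
    simp [tridiag, Fin.ext_iff]
  -- The first column of this minor has a single non-zero entry, the `-1` on top.
  have h2 : ((tridiag (s + 2)).submatrix Fin.succ (Fin.succAbove 1)).det = -(tridiag s).det := by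
    rw [Matrix.det_succ_column_zero, Fin.sum_univ_succ, Finset.sum_eq_zero]
    · have h3 : ((tridiag (s + 2)).submatrix Fin.succ (Fin.succAbove 1)).submatrix
          (Fin.succAbove 0) Fin.succ = tridiag s := by
        ext1 a b
        have hb : (Fin.succAbove (1 : Fin (s + 2)) b.succ).val = b.val + 2 := by
          rw [← Fin.succ_zero_eq_one, Fin.succ_succAbove_succ]; simp
        simp [tridiag, Fin.ext_iff]
      rw [h3]
      simp [tridiag]
    · intro i _
      simp [tridiag, Fin.ext_iff]
  rw [Matrix.det_succ_row_zero, Fin.sum_univ_succ, Fin.sum_univ_succ, Finset.sum_eq_zero]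
  · rw [Fin.succAbove_zero, h1, Fin.succ_zero_eq_one, h2]
    simp [tridiag]
    ring
  · intro i _
    simp [tridiag, Fin.ext_iff]

/-- Swapping the factors gives `det (1 - z TᵀT)`. Multiplying by `Hᵀ` and `H`, with `H = T⁻¹` of
determinant `1`, turns the matrix into `HᵀH - z`, and `HᵀH` is the second-difference matrix with
corner entry `1`. -/
theorem detOneSub_stepMatrix (s : ℕ) :
    detOneSub (stepMatrix s * (stepMatrix s).transpose) = (tridiag s).det := by
  set c : ℚ →+* PowerSeries ℚ := PowerSeries.C with hc
  set T := (stepMatrix s).map c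
  set H := (stepMatrixInv s).map c with hH
  have hTH : T * H = 1 := by
    rw [← Matrix.map_mul, stepMatrixInv_mul, Matrix.map_one _ (map_zero c) (map_one c)]
  have hHT' : H.transpose * T.transpose = 1 := by
    rw [← Matrix.transpose_mul, hTH, Matrix.transpose_one]
  have hdet : H.det = 1 := by
    have := RingHom.map_det c (stepMatrixInv s)
    rw [det_stepMatrixInv, map_one] at this
    exact this.symm
  have h1 : detOneSub (stepMatrix s * (stepMatrix s).transpose) =
      (1 - (PowerSeries.X : PowerSeries ℚ) • (T.transpose * T)).det := by
    rw [detOneSub, Matrix.map_mul, ← Matrix.smul_mul, Matrix.det_one_sub_mul_comm,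
      Matrix.mul_smul]
    rfl
  have h2 : H.transpose * (1 - (PowerSeries.X : PowerSeries ℚ) • (T.transpose * T)) * H =
      H.transpose * H - (PowerSeries.X : PowerSeries ℚ) • 1 := by
    rw [mul_sub, sub_mul, mul_one, Matrix.mul_smul, Matrix.smul_mul]
    congr 2
    calc H.transpose * (T.transpose * T) * H = (H.transpose * T.transpose) * (T * H) := by
          simp only [Matrix.mul_assoc]
      _ = 1 := by rw [hHT', hTH, mul_one]
  have h3 : H.transpose * H - (PowerSeries.X : PowerSeries ℚ) • 1 = tridiag s := by
    ext1 a b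
    rw [Matrix.sub_apply, Matrix.mul_apply]
    have : ∀ i : Fin s, H.transpose a i * H i b =
      (if i = a then (if a = b then 1 else if b.val + 1 = a.val then -1 else 0) else 0) +
        (if a.val + 1 = i.val then (if a = b then 1 else if a.val + 1 = b.val then -1 else 0)
          else 0) := by
      intro i
      simp only [hH, Matrix.transpose_apply, Matrix.map_apply, stepMatrixInv, Matrix.of_apply,
        Fin.ext_iff]
      split_ifs <;> first | omega | simp
    simp only [this, Finset.sum_add_distrib, Finset.sum_ite_eq', Finset.mem_univ, if_true]
    rw [Fin.sum_ite_eq_val]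
    have := a.2
    have := b.2
    simp only [tridiag, Matrix.of_apply, Matrix.smul_apply, Matrix.one_apply, Fin.ext_iff]
    split_ifs <;> first | omega | (simp; try ring)
  have h4 := congrArg Matrix.det h2
  rw [Matrix.det_mul, Matrix.det_mul, Matrix.det_transpose, hdet, one_mul, mul_one, h3] at h4
  rw [h1, h4]

/-- Both sides satisfy the same three-term recurrence in `s`, so the induction carries two
consecutive values. -/
theorem tridiag_mul_cosArcsin (s : ℕ) :
    (tridiag s).det * cosArcsin (1 / 2) = cosArcsin (s + 1 / 2) := by
  have key : (tridiag s).det * cosArcsin (1 / 2) = cosArcsin (s + 1 / 2) ∧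
      (tridiag (s + 1)).det * cosArcsin (1 / 2) = cosArcsin ((s + 1 : ℕ) + 1 / 2) := by
    induction s with
    | zero =>
      -- Evenness identifies `cosArcsin (-1/2)` with `cosArcsin (1/2)`; this matches the corner
      -- entry `1 - z`.
      have h := cosArcsin_recurrence (1 / 2)
      rw [show (1 / 2 - 1 : ℚ) = -(1 / 2) by norm_num, cosArcsin_neg] at h
      constructor
      · simp
      · have e1 : (((0 + 1 : ℕ) : ℚ) + 1 / 2) = 1 / 2 + 1 := by push_cast; ring
        have e2 : (tridiag (0 + 1)).det = 1 - PowerSeries.X := by simp [tridiag]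
        rw [e1, e2]
        linear_combination -h
    | succ s ih =>
      refine ⟨ih.2, ?_⟩
      have h := cosArcsin_recurrence ((s + 1 : ℕ) + 1 / 2)
      rw [← ih.2] at h
      have e1 : (((s + 1 : ℕ) : ℚ) + 1 / 2 - 1) = s + 1 / 2 := by push_cast; ring
      have e2 : (((s + 1 : ℕ) : ℚ) + 1 / 2 + 1) = ((s + 1 + 1 : ℕ) : ℚ) + 1 / 2 := by
        push_cast; ring
      rw [e1, e2, ← ih.1] at h
      rw [det_tridiag_recurrence]
      linear_combination -h
  exact key.1

/-! ### Order-preserving maps of the crown as closed walks. -/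

/-- The product `M 0 * M 1 * ⋯ * M (m - 1)`. -/
def Matrix.prodUpTo {ι R : Type*} [Fintype ι] [DecidableEq ι] [CommRing R]
    (M : ℕ → Matrix ι ι R) : ℕ → Matrix ι ι R
  | 0 => 1
  | m + 1 => Matrix.prodUpTo M m * M m

/-- An arbitrary function `h` of the endpoints is allowed so that the induction can absorb the last
step of the path into it. -/
theorem Matrix.sum_paths {ι R : Type*} [Fintype ι] [DecidableEq ι] [CommRing R]
    (M : ℕ → Matrix ι ι R) (m : ℕ) (h : ι → ι → R) :
    ∑ f : Fin (m + 1) → ι, (∏ i : Fin m, M i (f i.castSucc) (f i.succ)) * h (f 0) (f (Fin.last m)) =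
      ∑ a, ∑ b, Matrix.prodUpTo M m a b * h a b := by
  induction m generalizing h with
  | zero =>
    rw [← (Equiv.funUnique (Fin 1) ι).symm.sum_comp]
    simp [Matrix.prodUpTo, Matrix.one_apply]
  | succ m ih =>
    rw [← (Fin.snocEquiv fun _ => ι).sum_comp, Fintype.sum_prod_type_right]
    have h1 : ∀ (f : Fin (m + 1) → ι) (b : ι),
        (∏ i : Fin (m + 1), M i (Fin.snocEquiv (fun _ => ι) (b, f) i.castSucc)
          (Fin.snocEquiv (fun _ => ι) (b, f) i.succ)) *
          h (Fin.snocEquiv (fun _ => ι) (b, f) 0)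
            (Fin.snocEquiv (fun _ => ι) (b, f) (Fin.last (m + 1))) =
        (∏ i : Fin m, M i (f i.castSucc) (f i.succ)) * (M m (f (Fin.last m)) b * h (f 0) b) := by
      intro f b
      rw [Fin.prod_univ_castSucc, mul_assoc]
      simp only [Fin.snocEquiv_apply, Fin.succ_last, Fin.snoc_last, Fin.val_last, Fin.snoc_castSucc,
        Fin.val_castSucc, ← Fin.castSucc_succ, ← Fin.castSucc_zero]
    simp only [h1, ← Finset.mul_sum]
    rw [ih fun a c => ∑ b, M m c b * h a b]
    refine Finset.sum_congr rfl fun a _ => ?_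
    simp only [Matrix.prodUpTo, Matrix.mul_apply, Finset.mul_sum, Finset.sum_mul]
    rw [Finset.sum_comm]
    simp only [mul_assoc]

theorem Matrix.sum_closed_paths {ι R : Type*} [Fintype ι] [DecidableEq ι] [CommRing R]
    (M : ℕ → Matrix ι ι R) (m : ℕ) :
    ∑ f : Fin (m + 1) → ι, (∏ i : Fin m, M i (f i.castSucc) (f i.succ)) *
      M m (f (Fin.last m)) (f 0) = (Matrix.prodUpTo M (m + 1)).trace := by
  rw [Matrix.sum_paths M m fun a b => M m b a]
  simp [Matrix.prodUpTo, Matrix.trace, Matrix.mul_apply]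

theorem Matrix.prodUpTo_alternating {ι R : Type*} [Fintype ι] [DecidableEq ι] [CommRing R]
    (A B : Matrix ι ι R) (n : ℕ) :
    Matrix.prodUpTo (fun i => if Even i then A else B) (2 * n) = (A * B) ^ n := by
  induction n with
  | zero => simp [Matrix.prodUpTo]
  | succ n ih =>
    rw [show 2 * (n + 1) = 2 * n + 1 + 1 by ring, Matrix.prodUpTo, Matrix.prodUpTo, ih, pow_succ,
      if_pos (even_two_mul n), if_neg (by simp), mul_assoc]

/-- Monotonicity is tested on the `2n + 1` edges of the zigzag and on the closing edge. -/
theorem monotone_crown_iff (n : ℕ) {α : Type*} [Preorder α] (f : Crown (n + 1) → α) :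
    Monotone f ↔ (∀ i : Fin (2 * n + 1), if Even i.val then
        f (i.succ : Fin (2 * n + 1 + 1)) ≤ f (i.castSucc : Fin (2 * n + 1 + 1))
        else f (i.castSucc : Fin (2 * n + 1 + 1)) ≤ f (i.succ : Fin (2 * n + 1 + 1))) ∧
      f (Fin.last (2 * n + 1) : Fin (2 * n + 1 + 1)) ≤ f (0 : Fin (2 * n + 1 + 1)) := by
  constructor
  · intro hf
    refine ⟨fun i => ?_, hf (Or.inr ⟨rfl, rfl⟩)⟩
    split_ifs with h
    · refine hf (Or.inl (Or.inr ⟨?_, Or.inr rfl⟩))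
      exact Even.add_one h
    · refine hf (Or.inl (Or.inr ⟨?_, Or.inl rfl⟩))
      exact Nat.not_even_iff_odd.1 h
  · rintro ⟨h1, h2⟩ a b hab
    have ha := a.2
    have hb := b.2
    rcases hab with (hab | ⟨hodd, hab | hab⟩) | ⟨h3, h4⟩
    · rw [show a = b from hab]
    · have h := h1 ⟨a.val, by omega⟩
      rw [if_neg (Nat.not_even_iff_odd.2 hodd)] at h
      have e : b = (Fin.succ ⟨a.val, by omega⟩ : Fin (2 * n + 1 + 1)) :=
        Fin.ext (n := 2 * n + 1 + 1) hab.symm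
      rw [congrArg f e]
      exact h
    · have h := h1 ⟨b.val, by omega⟩
      have he : Even b.val := by
        rw [Nat.odd_iff] at hodd; rw [Nat.even_iff]; omega
      rw [if_pos he] at h
      have e : a = (Fin.succ ⟨b.val, by omega⟩ : Fin (2 * n + 1 + 1)) :=
        Fin.ext (n := 2 * n + 1 + 1) hab.symm
      rw [congrArg f e]
      exact h
    · have e : a = Fin.last (2 * n + 1) :=
        Fin.ext (n := 2 * n + 1 + 1) (by rw [Fin.val_last]; omega)
      have e' : b = (0 : Fin (2 * n + 1 + 1)) := Fin.ext (n := 2 * n + 1 + 1) h4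
      rw [congrArg f e, congrArg f e']
      exact h2

/-- An edge leaving an even position goes down and contributes `T`; one leaving an odd position, the
closing edge included, goes up and contributes `Tᵀ`. -/
theorem card_crown_orderHom (n s : ℕ) :
    (Nat.card (Crown (n + 1) →o Fin s) : ℚ) =
      ((stepMatrix s * (stepMatrix s).transpose) ^ (n + 1)).trace := by
  classical
  rw [← Matrix.prodUpTo_alternating, show 2 * (n + 1) = (2 * n + 1) + 1 by ring,
    ← Matrix.sum_closed_paths]
  have e : (Crown (n + 1) →o Fin s) ≃
      {f : Fin (2 * n + 1 + 1) → Fin s // (∀ i : Fin (2 * n + 1), if Even i.val then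
        f i.succ ≤ f i.castSucc else f i.castSucc ≤ f i.succ) ∧
        f (Fin.last (2 * n + 1)) ≤ f 0} :=
    ⟨fun f => ⟨f.1, (monotone_crown_iff n f.1).1 f.2⟩,
      fun f => ⟨f.1, (monotone_crown_iff n f.1).2 f.2⟩, fun _ => rfl, fun _ => rfl⟩
  rw [Nat.card_congr e, Nat.card_eq_fintype_card, Fintype.card_subtype, Finset.card_filter]
  push_cast
  refine Finset.sum_congr rfl fun f _ => ?_
  have h1 : ∀ i : Fin (2 * n + 1), (if Even i.val then stepMatrix s else (stepMatrix s).transpose)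
      (f i.castSucc) (f i.succ) = if (if Even i.val then f i.succ ≤ f i.castSucc
        else f i.castSucc ≤ f i.succ) then 1 else 0 := by
    intro i
    split_ifs <;> simp_all [stepMatrix]
  simp only [h1]
  rw [if_neg (show ¬ Even (2 * n + 1) by simp), Finset.prod_boole,
    Matrix.transpose_apply, stepMatrix, Matrix.of_apply]
  simp only [Finset.mem_univ, true_imp_iff, ← ite_and, ite_mul, one_mul, zero_mul]

/-! ### The order polynomial of the crown and its coefficients. -/

theorem coeff_logSecArcsin (t : ℚ) (n : ℕ) : PowerSeries.coeff n (logSecArcsin t) =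
    ∑ j ∈ Finset.range (n + 1), PowerSeries.coeff j logSecSqrt *
        PowerSeries.coeff n (arcsinSq ^ j) * t ^ (2 * j) :=
  coeff_subst_mul_arcsinSq _ _ _

theorem cosArcsin_ne_zero (t : ℚ) : cosArcsin t ≠ 0 := by
  intro h
  have := coeff_zero_cosArcsin t
  rw [h] at this
  simp at this

/-- Minus the logarithmic derivative of `det (1 - z T Tᵀ) = cosArcsin (s + 1/2) / cosArcsin (1/2)`,
cleared of denominators. -/
theorem trace_series_eq (s : ℕ) :
    PowerSeries.X * PowerSeries.mk (fun n =>
      ((stepMatrix s * (stepMatrix s).transpose) ^ (n + 1)).trace) =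
    PowerSeries.X * PowerSeries.derivative ℚ (logSecArcsin (s + 1 / 2)) -
      PowerSeries.X * PowerSeries.derivative ℚ (logSecArcsin (1 / 2)) := by
  have h1 := derivative_detOneSub (stepMatrix s * (stepMatrix s).transpose)
  rw [detOneSub_stepMatrix] at h1
  set T := PowerSeries.mk fun n => ((stepMatrix s * (stepMatrix s).transpose) ^ (n + 1)).trace
  have h2 := derivative_logSecArcsin (s + 1 / 2)
  have h3 := derivative_logSecArcsin (1 / 2)
  have h4 := tridiag_mul_cosArcsin s
  have h5 := congrArg (PowerSeries.derivative ℚ) h4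
  rw [Derivation.leibniz, h1, smul_eq_mul, smul_eq_mul] at h5
  rw [← mul_sub]
  congr 1
  apply mul_right_cancel₀ (cosArcsin_ne_zero (s + 1 / 2))
  rw [sub_mul, h2, ← h5, ← h4]
  linear_combination (tridiag s).det * h3

/-- The part of `Ω(C_{2n}; t - 1/2)` of positive degree. -/
noncomputable def crownPoly (n : ℕ) : ℚ[X] :=
  ∑ j ∈ Finset.range (n + 1), C (n * (PowerSeries.coeff j logSecSqrt *
        PowerSeries.coeff n (arcsinSq ^ j))) * X ^ (2 * j)

theorem eval_crownPoly (n : ℕ) (t : ℚ) :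
    (crownPoly n).eval t = n * PowerSeries.coeff n (logSecArcsin t) := by
  rw [coeff_logSecArcsin, crownPoly, eval_finsetSum, Finset.mul_sum]
  refine Finset.sum_congr rfl fun j _ => ?_
  simp only [eval_mul, eval_C, eval_pow, eval_X]
  ring

/-- Both polynomials agree at `t = s + 1/2` for every natural `s`. The subtracted constant comes
from the denominator `cosArcsin (1/2)` and only affects degree `0`. -/
theorem orderPolynomial_crown_comp (n : ℕ) :
    (orderPolynomial (Crown (n + 1))).comp (X - C (1 / 2)) =
      crownPoly (n + 1) - C ((crownPoly (n + 1)).eval (1 / 2)) := by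
  have hinj : Function.Injective fun s : ℕ => (s + 1 / 2 : ℚ) := by
    intro a b hab
    simpa using hab
  refine Polynomial.eq_of_infinite_eval_eq _ _ ((Set.infinite_range_of_injective hinj).mono ?_)
  rintro _ ⟨s, rfl⟩
  have h := congrArg (PowerSeries.coeff (n + 1)) (trace_series_eq s)
  rw [PowerSeries.coeff_succ_X_mul, PowerSeries.coeff_mk, map_sub, coeff_X_mul_derivative,
    coeff_X_mul_derivative, ← eval_crownPoly, ← eval_crownPoly, ← card_crown_orderHom,
    ← orderPolynomial_eval] at h
  simp only [Set.mem_ofPred_eq, eval_comp, eval_sub, eval_X, eval_C, add_sub_cancel_right]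
  exact h

theorem coeff_crownPoly (n k : ℕ) : (crownPoly n).coeff (2 * k) =
    n * (PowerSeries.coeff k logSecSqrt * PowerSeries.coeff n (arcsinSq ^ k)) := by
  rw [crownPoly, finsetSum_coeff]
  simp only [coeff_C_mul, coeff_X_pow]
  rw [Finset.sum_eq_single k]
  · simp
  · intro j _ hj
    rw [if_neg (by omega), mul_zero]
  · intro hk
    rw [Finset.mem_range] at hk
    rw [coeff_arcsinSq_pow_of_lt (by omega)]
    simp

theorem coeff_crownPoly_of_odd (n k : ℕ) (hk : Odd k) : (crownPoly n).coeff k = 0 := by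
  rw [crownPoly, finsetSum_coeff]
  refine Finset.sum_eq_zero fun j _ => ?_
  rw [coeff_C_mul, coeff_X_pow, if_neg, mul_zero]
  rintro rfl
  exact (Nat.not_odd_iff_even.2 (even_two_mul j)) hk

theorem fHat_of_odd (n k : ℕ) (hk : Odd k) : fHat (n + 1) k = 0 := by
  rw [fHat, orderPolynomial_crown_comp, coeff_sub, coeff_crownPoly_of_odd _ _ hk,
    coeff_C_of_ne_zero (by rintro rfl; simp at hk)]
  simp

theorem fHat_even (n k : ℕ) (hk : k ≠ 0) : fHat (n + 1) (2 * k) =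
    Nat.factorial (2 * (n + 1)) * ((n + 1) * (PowerSeries.coeff k logSecSqrt *
      PowerSeries.coeff (n + 1) (arcsinSq ^ k))) := by
  rw [fHat, orderPolynomial_crown_comp, coeff_sub, coeff_crownPoly,
    coeff_C_of_ne_zero (by omega), sub_zero]
  push_cast
  ring

theorem coeff_arcsinSq_pow_self (n : ℕ) : PowerSeries.coeff n (arcsinSq ^ n) = 1 := by
  rw [arcsinSq_eq, mul_pow, PowerSeries.coeff_X_pow_mul', if_pos le_rfl, Nat.sub_self,
    PowerSeries.coeff_zero_eq_constantCoeff, map_pow, map_mul]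
  simp [wPlusSeries, wMinusSeries, wPlus, wMinus]

/-! ### Leading coefficients and linear extensions: the coefficients of `-log cos √u`. -/

/-- Only the top term of the binomial expansion reaches degree `|P|`, and a shift of the variable
keeps its leading coefficient. -/
theorem coeff_orderPolynomial_card (P : Type) [PartialOrder P] [Fintype P] (p : ℚ[X])
    (c : ℚ) (hp : p = (orderPolynomial P).comp (X - C c)) :
    p.coeff (Fintype.card P) = numLinearExtensions P / Nat.factorial (Fintype.card P) := by
  have hd : ∀ j : ℕ, ((descPochhammer ℚ j).comp (X - C c)).Monic ∧
      ((descPochhammer ℚ j).comp (X - C c)).natDegree = j := fun j => by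
    constructor
    · exact (monic_descPochhammer ℚ j).comp_X_sub_C c
    · rw [natDegree_comp, natDegree_X_sub_C, mul_one, descPochhammer_natDegree]
  rw [hp, orderPolynomial, Polynomial.sum_comp, finsetSum_coeff, Finset.sum_range_succ,
    Finset.sum_eq_zero, zero_add, mul_comp, C_comp, coeff_C_mul]
  · have h := (hd (Fintype.card P)).1.coeff_natDegree
    rw [(hd (Fintype.card P)).2] at h
    rw [h, mul_one, numLinearExtensions]
  · intro j hj
    rw [mul_comp, C_comp, coeff_C_mul, coeff_eq_zero_of_natDegree_lt, mul_zero]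
    rw [(hd j).2]
    simpa using hj

/-- Comparison of leading coefficients, where `[z^{n+1}] A^{n+1} = 1`. -/
theorem coeff_logSecSqrt (n : ℕ) : (n + 1) * PowerSeries.coeff (n + 1) logSecSqrt =
    numLinearExtensions (Crown (n + 1)) / Nat.factorial (2 * (n + 1)) := by
  have h := coeff_orderPolynomial_card (Crown (n + 1)) _ (1 / 2) rfl
  have hc : Fintype.card (Crown (n + 1)) = 2 * (n + 1) := Fintype.card_fin _
  rw [hc, orderPolynomial_crown_comp, coeff_sub, coeff_crownPoly, coeff_C_of_ne_zero (by omega),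
    sub_zero, coeff_arcsinSq_pow_self, mul_one] at h
  rw [← h]; push_cast; rfl

/-- The modulus is even, so parity survives cyclic addition. -/
theorem Fin.odd_val_add {n : ℕ} (a b : Fin (2 * n + 1 + 1)) :
    Odd (a + b).val ↔ Odd (a.val + b.val) := by
  have := a.2
  have := b.2
  rw [Fin.val_add_eq_ite, Nat.odd_iff, Nat.odd_iff]
  split_ifs <;> omega

theorem Fin.odd_val_sub {n : ℕ} (a b : Fin (2 * n + 1 + 1)) :
    Odd (a - b).val ↔ Odd (a.val + b.val) := by
  have h := Fin.odd_val_add (a - b) b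
  rw [sub_add_cancel] at h
  rw [Nat.odd_iff, Nat.odd_iff] at *
  omega

theorem Fin.val_add_one_cases {n : ℕ} (a : Fin (2 * n + 1 + 1)) :
    (a.val + 1 < 2 * n + 1 + 1 ∧ (a + 1).val = a.val + 1) ∨
      (a.val + 1 = 2 * n + 1 + 1 ∧ (a + 1).val = 0) := by
  have := a.2
  rw [Fin.val_add_eq_ite, Fin.val_one]
  split_ifs <;> omega

theorem crown_le_iff {n : ℕ} (a b : Fin (2 * n + 1 + 1)) :
    (show Crown (n + 1) from a) ≤ (show Crown (n + 1) from b) ↔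
      a = b ∨ (Odd a.val ∧ (b = a + 1 ∨ a = b + 1)) := by
  have ha := a.2
  have hb := b.2
  have h1 := Fin.val_add_one_cases a
  have h2 := Fin.val_add_one_cases b
  have h3 : (show Crown (n + 1) from a) ≤ (show Crown (n + 1) from b) ↔
    (a = b ∨ (Odd a.val ∧ (a.val + 1 = b.val ∨ b.val + 1 = a.val))) ∨
      (a.val + 1 = 2 * (n + 1) ∧ b.val = 0) := Iff.rfl
  rw [h3]
  simp only [Fin.ext_iff, Nat.odd_iff]
  omega

theorem zigzag_le_iff {n : ℕ} (a b : Fin n) :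
    (show Zigzag n from a) ≤ (show Zigzag n from b) ↔
      a = b ∨ (Odd a.val ∧ (a.val + 1 = b.val ∨ b.val + 1 = a.val)) := Iff.rfl

/-- The function on the crown that is maximal at `c` and is the dual of `g` on the rest. -/
def crownExtend {n : ℕ} (c : Fin (2 * n + 1 + 1)) (g : Zigzag (2 * n + 1) → Fin (2 * n + 1))
    (v : Fin (2 * n + 1 + 1)) : Fin (2 * n + 1 + 1) :=
  (Fin.cons (Fin.last (2 * n + 1)) fun j => (g j).rev.castSucc :
    Fin (2 * n + 1 + 1) → Fin (2 * n + 1 + 1)) (v - c)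

theorem crownExtend_self {n : ℕ} (c : Fin (2 * n + 1 + 1))
    (g : Zigzag (2 * n + 1) → Fin (2 * n + 1)) :
    crownExtend c g c = Fin.last (2 * n + 1) := by
  rw [crownExtend, sub_self, Fin.cons_zero]

theorem crownExtend_succ_add {n : ℕ} (c : Fin (2 * n + 1 + 1))
    (g : Zigzag (2 * n + 1) → Fin (2 * n + 1)) (j : Fin (2 * n + 1)) :
    crownExtend c g (j.succ + c) = (g j).rev.castSucc := by
  rw [crownExtend, add_sub_cancel_right, Fin.cons_succ]

theorem eq_or_eq_succ_add {n : ℕ} (c v : Fin (2 * n + 1 + 1)) :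
    v = c ∨ ∃ j : Fin (2 * n + 1), v = j.succ + c := by
  rcases Fin.eq_zero_or_eq_succ (v - c) with h | ⟨j, hj⟩
  · exact Or.inl (sub_eq_zero.1 h)
  · exact Or.inr ⟨j, by rw [← hj, sub_add_cancel]⟩

/-- Deleting an upper element `c` leaves a path that begins and ends with lower elements, which is
the dual of the zigzag. -/
theorem crown_succ_add_le_iff {n : ℕ} (c : Fin (2 * n + 1 + 1)) (hc : Even c.val)
    (j k : Fin (2 * n + 1)) :
    (show Crown (n + 1) from j.succ + c) ≤ (show Crown (n + 1) from k.succ + c) ↔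
      (show Zigzag (2 * n + 1) from k) ≤ (show Zigzag (2 * n + 1) from j) := by
  have e : ∀ a : Fin (2 * n + 1 + 1), a + c + 1 = a + 1 + c := fun a => add_right_comm a c 1
  rw [crown_le_iff, zigzag_le_iff, Fin.odd_val_add, add_left_inj, e, e, add_left_inj,
    add_left_inj]
  have h1 := Fin.val_add_one_cases j.succ
  have h2 := Fin.val_add_one_cases k.succ
  have := j.2
  have := k.2
  simp only [Fin.ext_iff, Fin.val_succ, Nat.odd_iff, Nat.even_iff] at *
  omega

theorem monotone_crownExtend {n : ℕ} (c : Fin (2 * n + 1 + 1)) (hc : Even c.val)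
    (g : Zigzag (2 * n + 1) →o Fin (2 * n + 1)) :
    Monotone (α := Crown (n + 1)) (crownExtend c g) := by
  intro v w hvw
  change Fin (2 * n + 1 + 1) at v w
  rcases eq_or_eq_succ_add c w with rfl | ⟨k, rfl⟩
  · exact (Fin.le_last _).trans_eq (crownExtend_self _ _).symm
  rcases eq_or_eq_succ_add c v with rfl | ⟨j, rfl⟩
  · rcases (crown_le_iff _ _).1 hvw with h | ⟨h, -⟩
    · rw [← h]
    · exact absurd hc (Nat.not_even_iff_odd.2 h)
  · refine (crownExtend_succ_add _ _ _).trans_le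
      (le_of_le_of_eq ?_ (crownExtend_succ_add _ _ _).symm)
    rw [Fin.castSucc_le_castSucc_iff, Fin.rev_le_rev]
    exact g.monotone ((crown_succ_add_le_iff c hc j k).1 hvw)

theorem surjective_crownExtend {n : ℕ} (c : Fin (2 * n + 1 + 1))
    (g : Zigzag (2 * n + 1) → Fin (2 * n + 1)) (hg : Function.Surjective g) :
    Function.Surjective (crownExtend c g) := by
  intro y
  induction y using Fin.lastCases with
  | last => exact ⟨c, crownExtend_self c g⟩
  | cast y =>
    obtain ⟨j, hj⟩ := hg y.rev
    change Fin (2 * n + 1) at j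
    exact ⟨j.succ + c, by rw [crownExtend_succ_add, hj, Fin.rev_rev]⟩

/-- The largest value is taken at one of the `n + 1` upper elements; the rest is a linear extension
of the dual zigzag. -/
theorem numLinearExtensions_crown (n : ℕ) :
    numLinearExtensions (Crown (n + 1)) = (n + 1) * eulerE (2 * n + 1) := by
  have hcz : Fintype.card (Zigzag (2 * n + 1)) = 2 * n + 1 := Fintype.card_fin _
  have hcc : Fintype.card (Crown (n + 1)) = 2 * n + 1 + 1 := Fintype.card_fin _
  rw [numLinearExtensions, eulerE, numLinearExtensions, hcz, hcc, surjCount, surjCount]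
  have hi : ∀ i : Fin (n + 1), 2 * i.val < 2 * n + 1 + 1 := fun i => by have := i.2; omega
  have hcard : Nat.card (Fin (n + 1) ×
      {g : Zigzag (2 * n + 1) →o Fin (2 * n + 1) // Function.Surjective g}) =
      (n + 1) * Nat.card {g : Zigzag (2 * n + 1) →o Fin (2 * n + 1) // Function.Surjective g} := by
    rw [Nat.card_prod, Nat.card_eq_fintype_card, Fintype.card_fin]
  rw [← hcard]
  symm
  refine Nat.card_congr (Equiv.ofBijective (fun p =>
    ⟨⟨crownExtend ⟨2 * p.1.val, hi p.1⟩ p.2.1, monotone_crownExtend _ (even_two_mul _) p.2.1⟩,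
      surjective_crownExtend ⟨2 * p.1.val, hi p.1⟩ p.2.1 p.2.2⟩) ⟨?_, ?_⟩)
  · rintro ⟨i, g, hg⟩ ⟨i', g', hg'⟩ h
    have h1 : ∀ v, crownExtend ⟨2 * i.val, hi i⟩ g v = crownExtend ⟨2 * i'.val, hi i'⟩ g' v :=
      fun v => congrArg (fun f => f.1 v) h
    have h2 : i = i' := by
      have h3 := h1 ⟨2 * i.val, hi i⟩
      rw [crownExtend_self] at h3
      rcases eq_or_eq_succ_add ⟨2 * i'.val, hi i'⟩ ⟨2 * i.val, hi i⟩ with h4 | ⟨j, h4⟩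
      · simp only [Fin.mk.injEq] at h4
        exact Fin.ext (by omega)
      · rw [h4, crownExtend_succ_add] at h3
        exact absurd h3.symm (Fin.castSucc_lt_last _).ne
    subst h2
    have h5 : g = g' := by
      ext1
      funext j
      change Fin (2 * n + 1) at j
      have h3 := h1 (Fin.succ j + ⟨2 * i.val, hi i⟩)
      rw [crownExtend_succ_add, crownExtend_succ_add] at h3
      exact Fin.rev_injective (Fin.castSucc_injective _ h3)
    subst h5
    rfl
  · rintro ⟨f, hf⟩
    have hinj : Function.Injective f := by
      have : Function.Injective (f : Fin (2 * n + 1 + 1) → Fin (2 * n + 1 + 1)) :=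
        Finite.injective_iff_surjective.2 hf
      exact this
    obtain ⟨v, hv⟩ := hf (Fin.last _)
    change Fin (2 * n + 1 + 1) at v
    -- A lower `v` carrying the top value would force its upper neighbour `v + 1` to carry it too.
    have heven : Even v.val := by
      by_contra hodd
      have hle : (show Crown (n + 1) from v) ≤ (show Crown (n + 1) from v + 1) :=
        (crown_le_iff v (v + 1)).2 (Or.inr ⟨Nat.not_even_iff_odd.1 hodd, Or.inl rfl⟩)
      have h1 := f.monotone hle
      have h2 : f (v + 1 : Fin (2 * n + 1 + 1)) = Fin.last _ :=
        le_antisymm (Fin.le_last _) (hv ▸ h1)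
      have h3 : (v + 1 : Fin (2 * n + 1 + 1)) = v := hinj (h2.trans hv.symm)
      simp at h3
    obtain ⟨i, hiv⟩ : ∃ i : Fin (n + 1), v = ⟨2 * i.val, hi i⟩ := by
      obtain ⟨r, hr⟩ := heven
      have := v.2
      exact ⟨⟨r, by omega⟩, Fin.ext (by simp; omega)⟩
    have hne : ∀ j : Fin (2 * n + 1), f (j.succ + v : Fin (2 * n + 1 + 1)) ≠ Fin.last _ := by
      intro j hj
      have h3 : (j.succ + v : Fin (2 * n + 1 + 1)) = v := hinj (hj.trans hv.symm)
      rw [add_eq_right] at h3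
      exact Fin.succ_ne_zero j h3
    let g : Zigzag (2 * n + 1) →o Fin (2 * n + 1) :=
      ⟨fun j => ((f (Fin.succ j + v : Fin (2 * n + 1 + 1))).castPred (hne j)).rev, by
        intro j k hjk
        rw [Fin.rev_le_rev, Fin.castPred_le_castPred_iff]
        exact f.monotone ((crown_succ_add_le_iff v heven k j).2 hjk)⟩
    have hg : Function.Surjective g := by
      have : Function.Surjective (g : Zigzag (2 * n + 1) → Fin (2 * n + 1)) := by
        refine Finite.injective_iff_surjective.1 fun j k hjk => ?_
        have h1 := hinj (Fin.castPred_inj.1 (Fin.rev_injective hjk))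
        exact Fin.succ_injective _ (add_right_cancel h1)
      exact this
    refine ⟨⟨i, g, hg⟩, ?_⟩
    ext1
    ext1
    funext w
    change Fin (2 * n + 1 + 1) at w
    change crownExtend ⟨2 * i.val, hi i⟩ g w = f w
    rw [← hiv]
    rcases eq_or_eq_succ_add v w with rfl | ⟨j, rfl⟩
    · rw [crownExtend_self, hv]
    · refine (crownExtend_succ_add _ _ _).trans ?_
      change ((f _).castPred _).rev.rev.castSucc = _
      rw [Fin.rev_rev, Fin.castSucc_castPred]

theorem coeff_logSecSqrt_eq (m : ℕ) : PowerSeries.coeff (m + 1) logSecSqrt =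
    eulerE (2 * m + 1) / Nat.factorial (2 * (m + 1)) := by
  have h := coeff_logSecSqrt m
  have hm : (m + 1 : ℚ) ≠ 0 := by positivity
  rw [numLinearExtensions_crown] at h
  apply mul_left_cancel₀ hm
  rw [h]
  push_cast
  ring

/-! ### Cyclic coordinates on the crown and its connected subsets. -/

section CrownCoordinates

variable {n : ℕ}

/-- The index of an element of the crown, counted cyclically from `p`. -/
def crownIdx (p : Crown (n + 1)) : Crown (n + 1) ≃ Fin (2 * n + 1 + 1) :=
  Equiv.subRight (G := Fin (2 * n + 1 + 1)) p

/-- The cyclic predecessor in the crown. -/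
def crownPred (p : Crown (n + 1)) : Crown (n + 1) :=
  HSub.hSub (α := Fin (2 * n + 1 + 1)) (β := Fin (2 * n + 1 + 1)) p 1

/-- The number of the element `z_{i+1}` of the crown, counted from `0`. -/
def crownVal (p : Crown (n + 1)) : ℕ := Fin.val (n := 2 * n + 1 + 1) p

theorem odd_crownIdx (p v : Crown (n + 1)) :
    Odd (crownIdx p v).val ↔ Odd (crownVal v + crownVal p) :=
  Fin.odd_val_sub (n := n) v p

theorem crownIdx_self (p : Crown (n + 1)) : crownIdx p p = 0 :=
  sub_self (G := Fin (2 * n + 1 + 1)) p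

theorem crownIdx_pred_self (p : Crown (n + 1)) : crownIdx p (crownPred p) = Fin.last _ := by
  have h : crownIdx p (crownPred p) + 1 = 0 := by
    have : ∀ a : Fin (2 * n + 1 + 1), a - 1 - a + 1 = 0 := fun a => by abel
    exact this p
  have h2 := Fin.val_add_one_cases (crownIdx p (crownPred p))
  rw [h] at h2
  refine Fin.ext ?_
  rw [Fin.val_last]
  simp at h2
  omega

theorem crownIdx_pred (p q : Crown (n + 1)) (h : crownIdx p q ≠ 0) :
    (crownIdx p (crownPred q)).val + 1 = (crownIdx p q).val := by
  have h1 : crownIdx p (crownPred q) + 1 = crownIdx p q := by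
    have : ∀ a b : Fin (2 * n + 1 + 1), a - 1 - b + 1 = a - b := fun a b => by abel
    exact this q p
  have h2 := Fin.val_add_one_cases (crownIdx p (crownPred q))
  rw [h1] at h2
  rcases h2 with h2 | h2
  · exact h2.2.symm
  · exact absurd (Fin.ext h2.2) h

theorem crown_le_iff_idx (p v w : Crown (n + 1)) :
    v ≤ w ↔ v = w ∨ (Odd (crownVal v) ∧
      (crownIdx p w = crownIdx p v + 1 ∨ crownIdx p v = crownIdx p w + 1)) := by
  have h : ∀ a b c : Fin (2 * n + 1 + 1), b - a = c - a + 1 ↔ b = c + 1 := fun a b c => by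
    rw [sub_add_eq_add_sub, sub_left_inj]
  have h1 : crownIdx p w = crownIdx p v + 1 ↔ @Eq (Fin (2 * n + 1 + 1)) w (Fin.add v 1) := h p w v
  have h2 : crownIdx p v = crownIdx p w + 1 ↔ @Eq (Fin (2 * n + 1 + 1)) v (Fin.add w 1) := h p v w
  rw [h1, h2]
  exact crown_le_iff v w

theorem even_crownVal_of_lt {v w : Crown (n + 1)} (h : v ≤ w) (hne : v ≠ w) :
    Odd (crownVal v) ∧ Even (crownVal w) := by
  rcases (crown_le_iff_idx v v w).1 h with h | ⟨h, h'⟩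
  · exact absurd h hne
  refine ⟨h, ?_⟩
  have h0 := odd_crownIdx v w
  have h1 := Fin.val_add_one_cases (crownIdx v w)
  rw [crownIdx_self] at h'
  rw [← Nat.not_odd_iff_even]
  intro hw
  have h2 : ¬ Odd (crownIdx v w).val := by
    rw [h0, Nat.not_odd_iff_even]
    exact hw.add_odd h
  rcases h' with h' | h'
  · rw [h', zero_add] at h2
    exact h2 (by simp)
  · rw [← h'] at h1
    simp only [Fin.val_zero] at h1
    rw [Nat.odd_iff] at h2
    omega

/-- Comparable elements of the crown are equal or cyclically adjacent. -/
theorem crownIdx_of_comparable (p : Crown (n + 1)) {v w : Crown (n + 1)} (h : v ≤ w ∨ w ≤ v) :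
    v = w ∨ (crownIdx p w).val = (crownIdx p v).val + 1 ∨
      (crownIdx p v).val = (crownIdx p w).val + 1 ∨
      ((crownIdx p v).val = 2 * n + 1 ∧ (crownIdx p w).val = 0) ∨
      ((crownIdx p w).val = 2 * n + 1 ∧ (crownIdx p v).val = 0) := by
  have h1 := Fin.val_add_one_cases (crownIdx p v)
  have h2 := Fin.val_add_one_cases (crownIdx p w)
  rw [crown_le_iff_idx p v w, crown_le_iff_idx p w v] at h
  simp only [Fin.ext_iff] at h
  have e : v = w ∨ (crownIdx p w).val = (crownIdx p v + 1).val ∨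
      (crownIdx p v).val = (crownIdx p w + 1).val := by
    rcases h with (h | ⟨-, h⟩) | (h | ⟨-, h⟩)
    · exact Or.inl h
    · exact Or.inr h
    · exact Or.inl h.symm
    · exact Or.inr h.symm
  rcases e with e | e
  · exact Or.inl e
  · right
    omega

theorem comparable_of_crownIdx (p : Crown (n + 1)) {v w : Crown (n + 1)}
    (h : (crownIdx p w).val = (crownIdx p v).val + 1) : v ≤ w ∨ w ≤ v := by
  have h1 := Fin.val_add_one_cases (crownIdx p v)
  have h3 : crownIdx p w = crownIdx p v + 1 := Fin.ext (by have := (crownIdx p w).2; omega)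
  rw [crown_le_iff_idx p v w, crown_le_iff_idx p w v]
  by_cases hv : Odd (crownVal v)
  · exact Or.inl (Or.inr ⟨hv, Or.inl h3⟩)
  · refine Or.inr (Or.inr ⟨?_, Or.inr h3⟩)
    have h4 := odd_crownIdx p v
    have h5 := odd_crownIdx p w
    rw [Nat.odd_iff] at *
    rw [Nat.odd_iff] at *
    omega

theorem isMin_crown_iff (v : Crown (n + 1)) : IsMin v ↔ Odd (crownVal v) := by
  constructor
  · intro h
    by_contra hv
    let w : Crown (n + 1) := (crownIdx v).symm 1
    have hw : crownIdx v w = 1 := Equiv.apply_symm_apply _ _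
    have h1 : (crownIdx v w).val = (crownIdx v v).val + 1 := by
      rw [hw, crownIdx_self]; simp
    have hne : v ≠ w := by
      rintro h2
      rw [← h2] at h1
      omega
    rcases comparable_of_crownIdx v h1 with h2 | h2
    · exact hv (even_crownVal_of_lt h2 hne).1
    · exact hne (le_antisymm (h h2) h2)
  · intro hv w hw
    by_cases h : w = v
    · rw [h]
    · exact absurd hv (Nat.not_odd_iff_even.2 (even_crownVal_of_lt hw h).2)

theorem isMax_crown_iff (v : Crown (n + 1)) : IsMax v ↔ Even (crownVal v) := by
  constructor
  · intro h
    by_contra hv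
    let w : Crown (n + 1) := (crownIdx v).symm 1
    have hw : crownIdx v w = 1 := Equiv.apply_symm_apply _ _
    have h1 : (crownIdx v w).val = (crownIdx v v).val + 1 := by
      rw [hw, crownIdx_self]; simp
    have hne : w ≠ v := by
      rintro h2
      rw [h2] at h1
      omega
    rcases comparable_of_crownIdx v h1 with h2 | h2
    · exact hne (le_antisymm (h h2) h2)
    · exact hv (even_crownVal_of_lt h2 hne).2
  · intro hv w hw
    by_cases h : v = w
    · rw [h]
    · exact absurd (even_crownVal_of_lt hw h).1 (Nat.not_odd_iff_even.2 hv)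

/-- An element strictly between two others would be both upper and lower, so convexity amounts to
connectedness. -/
theorem ordConnected_crown (s : Set (Crown (n + 1))) : s.OrdConnected := by
  refine ⟨fun a ha c hc b hb => ?_⟩
  by_cases h1 : a = b
  · rwa [← h1]
  by_cases h2 : b = c
  · rwa [h2]
  exact absurd (even_crownVal_of_lt hb.2 h2).1
    (Nat.not_odd_iff_even.2 (even_crownVal_of_lt hb.1 h1).2)

/-- A property passed along comparabilities inside `s` spreads along walks. -/
theorem connected_induction {P : Type} [PartialOrder P] {s : Finset P}
    (h : (SimpleGraph.fromRel fun a b : s => a ≤ b).Connected) (Q : P → Prop)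
    (hQ : ∀ a ∈ s, ∀ b ∈ s, Q a → (a ≤ b ∨ b ≤ a) → Q b) {a b : P} (ha : a ∈ s) (hb : b ∈ s)
    (hQa : Q a) : Q b := by
  obtain ⟨walk⟩ := h.preconnected ⟨a, ha⟩ ⟨b, hb⟩
  have key : ∀ (x y : s), (SimpleGraph.fromRel fun a b : s => a ≤ b).Walk x y → Q x → Q y := by
    intro x y w
    induction w with
    | nil => exact id
    | cons hadj _ ih =>
      intro hx
      rw [SimpleGraph.fromRel_adj] at hadj
      exact ih (hQ _ (Subtype.prop _) _ (Subtype.prop _) hx hadj.2)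
  exact key _ _ walk hQa

/-- A connected subset of the crown that is cut between `p` and its predecessor is an interval
for the indices counted from `p`. -/
theorem mem_of_connected_crown {s : Finset (Crown (n + 1))}
    (h : (SimpleGraph.fromRel fun a b : s => a ≤ b).Connected) (p : Crown (n + 1))
    (hp : ¬ (p ∈ s ∧ crownPred p ∈ s)) {u v w : Crown (n + 1)} (hu : u ∈ s) (hw : w ∈ s)
    (huv : crownIdx p u ≤ crownIdx p v) (hvw : crownIdx p v ≤ crownIdx p w) : v ∈ s := by
  by_contra hv
  have hne : ∀ x ∈ s, (crownIdx p x).val ≠ (crownIdx p v).val := fun x hx he =>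
    hv ((crownIdx p).injective (Fin.ext he) ▸ hx)
  have hends : ∀ x ∈ s, ∀ y ∈ s, ¬ ((crownIdx p x).val = 2 * n + 1 ∧ (crownIdx p y).val = 0) := by
    rintro x hx y hy ⟨h1, h2⟩
    refine hp ⟨?_, ?_⟩
    · have : p = y := (crownIdx p).injective (by rw [crownIdx_self]; exact Fin.ext h2.symm)
      rwa [this]
    · have : crownPred p = x :=
        (crownIdx p).injective (by rw [crownIdx_pred_self]; exact Fin.ext h1.symm)
      rwa [this]
  -- Inside `s` the index changes by one at each step, since `hends` excludes the wrap-around; it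
  -- cannot jump over the missing `v`.
  have h1 := connected_induction h (fun x => (crownIdx p x).val < (crownIdx p v).val)
    (fun a ha b hb hQ hab => by
      have h2 := hne b hb
      have h3 := hends a ha b hb
      have h4 := hends b hb a ha
      rcases crownIdx_of_comparable p hab with rfl | h5
      · exact hQ
      · omega) hu hw (lt_of_le_of_ne huv (hne u hu))
  exact absurd h1 (not_lt.2 hvw)

/-- Elements with consecutive indices are comparable, so an interval can be walked through. -/
theorem connected_crown_interval (s : Finset (Crown (n + 1))) (p : Crown (n + 1))
    (hs : s.Nonempty) (h : ∀ u ∈ s, ∀ w ∈ s, ∀ v, crownIdx p u ≤ crownIdx p v →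
      crownIdx p v ≤ crownIdx p w → v ∈ s) :
    (SimpleGraph.fromRel fun a b : s => a ≤ b).Connected := by
  have key : ∀ (m : ℕ) (u w : s), (crownIdx p w.1).val = (crownIdx p u.1).val + m →
      (SimpleGraph.fromRel fun a b : s => a ≤ b).Reachable u w := by
    intro m
    induction m with
    | zero =>
      intro u w huw
      have : u = w := Subtype.ext ((crownIdx p).injective (Fin.ext huw.symm))
      rw [this]
    | succ m ih =>
      intro u w huw
      obtain ⟨v, hv⟩ := (crownIdx p).surjective
        ⟨(crownIdx p u.1).val + m, by have := (crownIdx p w.1).2; omega⟩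
      have hv' := congrArg Fin.val hv
      have hvs : v ∈ s := h u u.2 w w.2 v (Fin.le_def.2 (by simp [hv']))
        (Fin.le_def.2 (by simp [hv']; omega))
      refine (ih u ⟨v, hvs⟩ hv').trans (SimpleGraph.Adj.reachable ?_)
      rw [SimpleGraph.fromRel_adj]
      simp only at hv'
      refine ⟨?_, comparable_of_crownIdx p (by simp only; omega)⟩
      rintro rfl
      simp only at huw
      omega
  have : Nonempty s := hs.to_subtype
  refine ⟨fun u w => ?_⟩
  rcases le_total (crownIdx p u.1) (crownIdx p w.1) with h1 | h1
  · exact key _ u w (Nat.add_sub_cancel' h1).symm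
  · exact (key _ w u (Nat.add_sub_cancel' h1).symm).symm

/-- A proper connected non-empty subset of the crown has exactly one element whose predecessor is
outside. -/
theorem card_start_eq_one {s : Finset (Crown (n + 1))}
    (h : (SimpleGraph.fromRel fun a b : s => a ≤ b).Connected) (hs : s ≠ Finset.univ) :
    (s.filter fun p => crownPred p ∉ s).card = 1 := by
  rw [Finset.card_eq_one]
  obtain ⟨⟨q, hq⟩⟩ := h.nonempty
  obtain ⟨p, hp, hp'⟩ : ∃ p ∈ s, crownPred p ∉ s := by
    by_contra hcon
    push Not at hcon
    apply hs
    -- If `s` is closed under predecessors, walking backwards from `q` reaches the whole cycle; `m`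
    -- is the number of steps taken from the predecessor of `q`.
    have key : ∀ (m : ℕ) (v : Crown (n + 1)), (crownIdx q v).val + m = 2 * n + 1 → v ∈ s := by
      intro m
      induction m with
      | zero =>
        intro v hv
        have : v = crownPred q :=
          (crownIdx q).injective (by rw [crownIdx_pred_self]; exact Fin.ext hv)
        rw [this]
        exact hcon q hq
      | succ m ih =>
        intro v hv
        obtain ⟨w, hw⟩ := (crownIdx q).surjective ⟨(crownIdx q v).val + 1, by omega⟩
        have hw' := congrArg Fin.val hw
        simp only at hw'
        have h1 := crownIdx_pred q w (by intro h0; rw [h0] at hw'; simp at hw')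
        have : v = crownPred w := (crownIdx q).injective (Fin.ext (by omega))
        rw [this]
        exact hcon w (ih w (by omega))
    exact Finset.eq_univ_of_forall fun v =>
      key (2 * n + 1 - (crownIdx q v).val) v (by have := (crownIdx q v).2; omega)
  refine ⟨p, Finset.eq_singleton_iff_unique_mem.2
    ⟨Finset.mem_filter.2 ⟨hp, hp'⟩, fun x hx => ?_⟩⟩
  rw [Finset.mem_filter] at hx
  by_contra hne
  have h0 : crownIdx p x ≠ 0 := fun h0 => hne ((crownIdx p).injective (by rw [h0, crownIdx_self]))
  have h1 := crownIdx_pred p x h0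
  refine hx.2 (mem_of_connected_crown h p (fun h2 => hp' h2.2) hp hx.1 ?_ ?_)
  · rw [crownIdx_self]; exact Fin.zero_le _
  · rw [Fin.le_def]; omega

end CrownCoordinates

/-! ### Monotone maps with odd fibres as compositions into odd parts. -/

section MonotoneMaps

variable {N k : ℕ}

/-- The number of points that a map to `Fin k` sends below `i`. -/
def cutPoint (g : Fin N → Fin k) (i : ℕ) : ℕ := (Finset.univ.filter fun j => (g j).val < i).card

theorem lt_cutPoint_iff {g : Fin N → Fin k} (hg : Monotone g) (i : ℕ) (j : Fin N) :
    j.val < cutPoint g i ↔ (g j).val < i := by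
  constructor
  · intro h
    by_contra hj
    refine absurd h (not_lt.2 ?_)
    have h1 : (Finset.univ.filter fun j => (g j).val < i) ⊆ Finset.Iio j := by
      intro x hx
      rw [Finset.mem_filter] at hx
      rw [Finset.mem_Iio]
      by_contra hx'
      have := Fin.le_def.1 (hg (not_lt.1 hx'))
      omega
    have h2 := Finset.card_le_card h1
    rwa [Fin.card_Iio] at h2
  · intro h
    have h1 : Finset.Iic j ⊆ (Finset.univ.filter fun j => (g j).val < i) := by
      intro x hx
      rw [Finset.mem_Iic] at hx
      rw [Finset.mem_filter]
      have := Fin.le_def.1 (hg hx)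
      exact ⟨Finset.mem_univ _, by omega⟩
    have h2 := Finset.card_le_card h1
    rw [Fin.card_Iic] at h2
    exact h2

theorem cutPoint_zero (g : Fin N → Fin k) : cutPoint g 0 = 0 := by
  simp [cutPoint]

theorem cutPoint_le (g : Fin N → Fin k) (i : ℕ) : cutPoint g i ≤ N :=
  (Finset.card_le_univ _).trans_eq (Fintype.card_fin N)

theorem cutPoint_succ (g : Fin N → Fin k) (i : Fin k) :
    cutPoint g (i + 1) = cutPoint g i + (Finset.univ.filter fun j => g j = i).card := by
  rw [cutPoint, cutPoint, ← Finset.card_union_of_disjoint]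
  · congr 1
    ext j
    simp only [Finset.mem_filter, Finset.mem_union, Finset.mem_univ, true_and, Fin.ext_iff]
    omega
  · rw [Finset.disjoint_filter]
    rintro j - h rfl
    omega

theorem eq_iff_cutPoint {g : Fin N → Fin k} (hg : Monotone g) (i : Fin k) (j : Fin N) :
    g j = i ↔ cutPoint g i ≤ j.val ∧ j.val < cutPoint g (i + 1) := by
  rw [lt_cutPoint_iff hg, ← not_lt, lt_cutPoint_iff hg, Fin.ext_iff]
  omega

/-- `cutPoint g i` is a sum of `i` odd fibre sizes. -/
theorem odd_cutPoint {g : Fin N → Fin k}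
    (ho : ∀ i, Odd (Finset.univ.filter fun j => g j = i).card) (i : ℕ) (hi : i ≤ k) :
    Odd (cutPoint g i) ↔ Odd i := by
  induction i with
  | zero => rw [cutPoint_zero]
  | succ i ih =>
    have h1 := cutPoint_succ g ⟨i, hi⟩
    have h2 := ho ⟨i, hi⟩
    have h3 := ih (by omega)
    simp only [Nat.odd_iff] at *
    omega

theorem card_filter_interval {V : Type*} [Fintype V] (e : V ≃ Fin N) {g : Fin N → Fin k}
    (hg : Monotone g) (i : Fin k) (Q : ℕ → Prop) [DecidablePred Q] :
    ((Finset.univ.filter fun v => g (e v) = i).filter fun v => Q (e v).val).card =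
      ((Finset.Ico (cutPoint g i) (cutPoint g (i + 1))).filter Q).card := by
  refine Finset.card_bij (fun v _ => (e v).val) ?_ ?_ ?_
  · intro v hv
    simp only [Finset.mem_filter, Finset.mem_univ, true_and, eq_iff_cutPoint hg] at hv
    rw [Finset.mem_filter, Finset.mem_Ico]
    exact hv
  · intro v _ w _ h
    exact e.injective (Fin.ext h)
  · intro x hx
    rw [Finset.mem_filter, Finset.mem_Ico] at hx
    have hN := cutPoint_le g (i + 1)
    refine ⟨e.symm ⟨x, by omega⟩, ?_, by simp⟩
    simp only [Finset.mem_filter, Finset.mem_univ, true_and, eq_iff_cutPoint hg,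
      Equiv.apply_symm_apply]
    exact hx

/-- In an interval of odd length the parity of the first element has a majority of one. -/
theorem card_odd_interval (a m c : ℕ) :
    ((Finset.Ico a (a + (2 * m + 1))).filter fun x => Odd (x + c)).card =
        (if Odd (a + c) then m + 1 else m) ∧
      ((Finset.Ico a (a + (2 * m + 1))).filter fun x => Even (x + c)).card =
        (if Odd (a + c) then m else m + 1) := by
  induction m with
  | zero =>
    rw [show a + (2 * 0 + 1) = a + 1 by ring, Nat.Ico_succ_singleton, Finset.filter_singleton,
      Finset.filter_singleton]
    by_cases h : Odd (a + c)
    · simp [h]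
    · simp [h, Nat.not_odd_iff_even.1 h]
  | succ m ih =>
    rw [show a + (2 * (m + 1) + 1) = a + (2 * m + 1) + 1 + 1 by ring,
      ← Finset.insert_Ico_right_eq_Ico_add_one (by omega),
      ← Finset.insert_Ico_right_eq_Ico_add_one (by omega), Finset.filter_insert,
      Finset.filter_insert, Finset.filter_insert, Finset.filter_insert]
    by_cases h : Odd (a + c)
    · have h1 : ¬ Odd (a + (2 * m + 1) + c) := by rw [Nat.odd_iff] at *; omega
      have h2 : Odd (a + (2 * m + 1) + 1 + c) := by rw [Nat.odd_iff] at *; omega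
      simp only [h, if_true] at ih ⊢
      rw [if_pos h2, if_neg h1, if_neg (Nat.not_even_iff_odd.2 h2),
        if_pos (Nat.not_odd_iff_even.1 h1), Finset.card_insert_of_notMem,
        Finset.card_insert_of_notMem, ih.1, ih.2]
      · simp
      · simp
      · simp
    · have h1 : Odd (a + (2 * m + 1) + c) := by rw [Nat.odd_iff] at *; omega
      have h2 : ¬ Odd (a + (2 * m + 1) + 1 + c) := by rw [Nat.odd_iff] at *; omega
      simp only [h, if_false] at ih ⊢
      rw [if_neg h2, if_pos h1, if_neg (Nat.not_even_iff_odd.2 h1),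
        if_pos (Nat.not_odd_iff_even.1 h2), Finset.card_insert_of_notMem,
        Finset.card_insert_of_notMem, ih.1, ih.2]
      · simp
      · simp
      · simp

theorem monotone_eq_of_card_fibers {g g' : Fin N → Fin k} (hg : Monotone g) (hg' : Monotone g')
    (h : ∀ i, (Finset.univ.filter fun j => g j = i).card =
      (Finset.univ.filter fun j => g' j = i).card) : g = g' := by
  have hc : ∀ i ≤ k, cutPoint g i = cutPoint g' i := by
    intro i
    induction i with
    | zero => intro _; rw [cutPoint_zero, cutPoint_zero]
    | succ i ih =>
      intro hi
      have h1 := cutPoint_succ g ⟨i, hi⟩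
      have h2 := cutPoint_succ g' ⟨i, hi⟩
      have h3 := h ⟨i, hi⟩
      have h4 := ih (by omega)
      simp only at h1 h2
      omega
  funext j
  symm
  rw [eq_iff_cutPoint hg', ← hc _ (by have := (g j).2; omega), ← hc _ (g j).2,
    ← eq_iff_cutPoint hg]

theorem exists_monotone_card_fibers (l : Fin k → ℕ) (hl : ∑ i, l i = N) :
    ∃ g : Fin N → Fin k, Monotone g ∧ ∀ i, (Finset.univ.filter fun j => g j = i).card = l i := by
  classical
  -- The partial sums are the cut points; `j` is sent to the first `i` with `j < σ (i + 1)`.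
  let σ : ℕ → ℕ := fun i => ∑ i' ∈ Finset.range i, if h : i' < k then l ⟨i', h⟩ else 0
  have hσ : Monotone σ := by
    refine monotone_nat_of_le_succ fun i => ?_
    simp only [σ, Finset.sum_range_succ]
    omega
  have hσs : ∀ i : Fin k, σ (i + 1) = σ i + l i := fun i => by
    simp [σ, Finset.sum_range_succ]
  have hσk : σ k = N := by
    rw [← hl, Finset.sum_fin_eq_sum_range]
  have hex : ∀ j : Fin N, ∃ i, j.val < σ (i + 1) := fun j =>
    ⟨k, (hσk ▸ j.2 : j.val < σ k).trans_le (hσ (Nat.le_succ k))⟩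
  have hlt : ∀ j : Fin N, Nat.find (hex j) < k := by
    intro j
    have hk : k ≠ 0 := by
      rintro rfl
      have := j.2
      simp at hl
      omega
    have : Nat.find (hex j) ≤ k - 1 := Nat.find_min' (hex j) (by
      rw [Nat.sub_add_cancel (Nat.one_le_iff_ne_zero.2 hk), hσk]; exact j.2)
    omega
  refine ⟨fun j => ⟨Nat.find (hex j), hlt j⟩, ?_, ?_⟩
  · intro j j' hjj
    rw [Fin.mk_le_mk]
    exact Nat.find_min' _ (lt_of_le_of_lt (Fin.le_def.1 hjj) (Nat.find_spec (hex j')))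
  · intro i
    have h1 : ∀ j : Fin N, (⟨Nat.find (hex j), hlt j⟩ : Fin k) = i ↔ σ i ≤ j ∧ j < σ (i + 1) := by
      intro j
      rw [Fin.ext_iff, Nat.find_eq_iff, and_comm]
      refine and_congr_left fun _ => ⟨fun h => ?_, fun h m hm => ?_⟩
      · rcases Nat.eq_zero_or_pos i.val with h0 | h0
        · simp [h0, σ]
        · have := h (i.val - 1) (by omega)
          rw [Nat.sub_add_cancel h0] at this
          exact not_lt.1 this
      · exact not_lt.2 ((hσ hm).trans h)
    simp only [h1]
    have h2 : (Finset.univ.filter fun j : Fin N => σ i ≤ j ∧ j < σ (i + 1)).card =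
        (Finset.Ico (σ i) (σ (i + 1))).card := by
      have hN : σ (i + 1) ≤ N := hσk ▸ hσ i.2
      refine Finset.card_bij (fun v _ => v.val) ?_ ?_ ?_
      · intro v hv
        simpa using hv
      · intro v _ w _ h
        exact Fin.ext h
      · intro x hx
        rw [Finset.mem_Ico] at hx
        exact ⟨⟨x, by omega⟩, by simpa using hx, rfl⟩
    rw [h2, Nat.card_Ico, hσs]
    omega

open Classical in
/-- The monotone maps with odd fibres. -/
noncomputable def oddMaps (N k : ℕ) : Finset (Fin N → Fin k) :=
  Finset.univ.filter fun g => Monotone g ∧ ∀ i, Odd (Finset.univ.filter fun j => g j = i).card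

theorem mem_oddMaps {g : Fin N → Fin k} : g ∈ oddMaps N k ↔
    Monotone g ∧ ∀ i, Odd (Finset.univ.filter fun j => g j = i).card := by
  classical
  rw [oddMaps, Finset.mem_filter]
  simp

/-- A map is determined by its fibre sizes `2 l_i + 1`, and these range over all `l` with `∑ l_i =
d`, as in the coefficient of a product. -/
theorem sum_oddMaps (d k : ℕ) (w : Fin k → ℕ → ℚ) :
    ∑ g ∈ oddMaps (2 * d + k) k, ∏ i, w i ((Finset.univ.filter fun j => g j = i).card / 2) =
      PowerSeries.coeff d (∏ i, PowerSeries.mk (w i)) := by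
  classical
  rw [PowerSeries.coeff_prod]
  refine Finset.sum_bij (fun g _ => Finsupp.equivFunOnFinite.symm
    fun i => (Finset.univ.filter fun j => g j = i).card / 2) ?_ ?_ ?_ ?_
  · intro g hg
    rw [mem_oddMaps] at hg
    rw [Finset.mem_finsuppAntidiag]
    refine ⟨?_, Finset.subset_univ _⟩
    have h1 : ∑ i, (Finset.univ.filter fun j => g j = i).card = 2 * d + k := by
      rw [← Finset.card_eq_sum_card_fiberwise (fun _ _ => Finset.mem_univ _), Finset.card_univ,
        Fintype.card_fin]
    have h2 : ∀ i, (Finset.univ.filter fun j => g j = i).card =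
        2 * ((Finset.univ.filter fun j => g j = i).card / 2) + 1 := fun i => by
      have := hg.2 i
      rw [Nat.odd_iff] at this
      omega
    rw [Finset.sum_congr rfl fun i _ => h2 i, Finset.sum_add_distrib, ← Finset.mul_sum] at h1
    simp at h1 ⊢
    exact h1
  · intro g hg g' hg' h
    rw [mem_oddMaps] at hg hg'
    refine monotone_eq_of_card_fibers hg.1 hg'.1 fun i => ?_
    have h1 : (Finset.univ.filter fun j => g j = i).card / 2 =
      (Finset.univ.filter fun j => g' j = i).card / 2 :=
        congrFun (Finsupp.equivFunOnFinite.symm.injective h) i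
    have h2 := hg.2 i
    have h3 := hg'.2 i
    rw [Nat.odd_iff] at h2 h3
    omega
  · intro l hl
    rw [Finset.mem_finsuppAntidiag] at hl
    obtain ⟨g, hg, hc⟩ := exists_monotone_card_fibers (N := 2 * d + k) (fun i => 2 * l i + 1) (by
      rw [Finset.sum_add_distrib, ← Finset.mul_sum, hl.1]; simp)
    refine ⟨g, mem_oddMaps.2 ⟨hg, fun i => ?_⟩, ?_⟩
    · rw [hc]; exact odd_two_mul_add_one _
    · ext i
      simp only [Finsupp.equivFunOnFinite_symm_apply_apply, hc]
      omega
  · intro g _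
    simp

end MonotoneMaps

/-! ### Standard decompositions into odd arcs. -/

section CrownDecompositions

variable {n k : ℕ}

/-- The arc of the crown that a labelling of the indices counted from `p` sends to `i`. -/
def crownBlock (p : Crown (n + 1)) (g : Fin (2 * n + 1 + 1) → Fin k) (i : Fin k) :
    Finset (Crown (n + 1)) :=
  Finset.univ.filter fun v => g (crownIdx p v) = i

theorem mem_crownBlock {p : Crown (n + 1)} {g : Fin (2 * n + 1 + 1) → Fin k} {i : Fin k}
    {v : Crown (n + 1)} : v ∈ crownBlock p g i ↔ g (crownIdx p v) = i := by
  simp [crownBlock]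

/-- The partition of the crown by a labelling of the indices counted from `p`. -/
noncomputable def crownPartition (p : Crown (n + 1)) (g : Fin (2 * n + 1 + 1) → Fin k) :
    Finpartition (Finset.univ : Finset (Crown (n + 1))) :=
  haveI : DecidableRel (Setoid.ker fun v => g (crownIdx p v)) := Classical.decRel _
  Finpartition.ofSetoid (Setoid.ker fun v => g (crownIdx p v))

theorem part_crownPartition (p : Crown (n + 1)) (g : Fin (2 * n + 1 + 1) → Fin k)
    (v : Crown (n + 1)) : (crownPartition p g).part v = crownBlock p g (g (crownIdx p v)) := by
  ext w
  rw [mem_crownBlock]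
  let : DecidableRel (Setoid.ker fun v => g (crownIdx p v)) := Classical.decRel _
  rw [crownPartition, Finpartition.mem_part_ofSetoid_iff_rel]
  exact eq_comm

theorem Finpartition.parts_eq_image_part {V : Type*} [Fintype V] [DecidableEq V]
    (μ : Finpartition (Finset.univ : Finset V)) : μ.parts = Finset.univ.image μ.part := by
  ext s
  rw [Finset.mem_image]
  constructor
  · intro hs
    obtain ⟨v, hv⟩ := μ.nonempty_of_mem_parts hs
    exact ⟨v, Finset.mem_univ _, μ.part_eq_of_mem hs hv⟩
  · rintro ⟨v, -, rfl⟩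
    exact μ.part_mem.2 (Finset.mem_univ _)

variable {g : Fin (2 * n + 1 + 1) → Fin k}

theorem surjective_of_mem_oddMaps {N : ℕ} {g : Fin N → Fin k} (hg : g ∈ oddMaps N k) :
    Function.Surjective g := by
  intro i
  have h := (mem_oddMaps.1 hg).2 i
  obtain ⟨j, hj⟩ := Finset.card_pos.1 h.pos
  exact ⟨j, by simpa using hj⟩

theorem parts_crownPartition (p : Crown (n + 1)) (hg : g ∈ oddMaps (2 * n + 1 + 1) k) :
    (crownPartition p g).parts = Finset.univ.image (crownBlock p g) := by
  rw [Finpartition.parts_eq_image_part]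
  ext s
  simp only [Finset.mem_image, Finset.mem_univ, true_and, part_crownPartition]
  constructor
  · rintro ⟨v, rfl⟩
    exact ⟨_, rfl⟩
  · rintro ⟨i, rfl⟩
    obtain ⟨j, rfl⟩ := surjective_of_mem_oddMaps hg i
    exact ⟨(crownIdx p).symm j, by rw [Equiv.apply_symm_apply]⟩

theorem crownBlock_nonempty (p : Crown (n + 1)) (hg : g ∈ oddMaps (2 * n + 1 + 1) k) (i : Fin k) :
    (crownBlock p g i).Nonempty := by
  obtain ⟨j, hj⟩ := surjective_of_mem_oddMaps hg i
  exact ⟨(crownIdx p).symm j, mem_crownBlock.2 (by rw [Equiv.apply_symm_apply, hj])⟩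

theorem crownBlock_injective (p : Crown (n + 1)) (hg : g ∈ oddMaps (2 * n + 1 + 1) k) :
    Function.Injective (crownBlock p g) := by
  intro i i' h
  obtain ⟨v, hv⟩ := crownBlock_nonempty p hg i
  rw [← mem_crownBlock.1 hv]
  rw [h] at hv
  exact mem_crownBlock.1 hv

theorem card_crownBlock (p : Crown (n + 1)) (g : Fin (2 * n + 1 + 1) → Fin k) (i : Fin k) :
    (crownBlock p g i).card = (Finset.univ.filter fun j => g j = i).card := by
  refine Finset.card_bij (fun v _ => crownIdx p v) ?_ ?_ ?_
  · intro v hv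
    simpa using mem_crownBlock.1 hv
  · intro v _ w _ h
    exact (crownIdx p).injective h
  · intro j hj
    exact ⟨(crownIdx p).symm j, mem_crownBlock.2 (by simpa using hj), by simp⟩

theorem odd_crownVal_iff (p v : Crown (n + 1)) :
    Odd (crownVal v) ↔ Odd ((crownIdx p v).val + crownVal p) := by
  have h := odd_crownIdx p v
  simp only [Nat.odd_iff] at *
  omega

/-- The block begins at index `cutPoint g i`, of the parity of `i`, and the type of its first
element has the majority. -/
theorem blockWeight_crownBlock (p : Crown (n + 1)) (hg : g ∈ oddMaps (2 * n + 1 + 1) k)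
    (i : Fin k) : blockWeight (crownBlock p g i) =
      (if Odd (crownVal p + i) then wPlus else wMinus)
        ((Finset.univ.filter fun j => g j = i).card / 2) := by
  classical
  have hg' := mem_oddMaps.1 hg
  obtain ⟨m, hm⟩ := hg'.2 i
  have h1 : ((crownBlock p g i).filter fun a => IsMin a).card =
      if Odd (cutPoint g i + crownVal p) then m + 1 else m := by
    rw [← (card_odd_interval _ m _).1, ← hm, ← cutPoint_succ,
      ← card_filter_interval (crownIdx p) hg'.1]
    congr 1
    ext v
    simp only [Finset.mem_filter, crownBlock, isMin_crown_iff, ← odd_crownVal_iff]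
  have h2 : ((crownBlock p g i).filter fun a => IsMax a).card =
      if Odd (cutPoint g i + crownVal p) then m else m + 1 := by
    rw [← (card_odd_interval _ m _).2, ← hm, ← cutPoint_succ,
      ← card_filter_interval (crownIdx p) hg'.1]
    congr 1
    ext v
    simp only [Finset.mem_filter, crownBlock, isMax_crown_iff, ← Nat.not_odd_iff_even,
      ← odd_crownVal_iff]
  have h3 : Odd (cutPoint g i + crownVal p) ↔ Odd (crownVal p + i) := by
    have := odd_cutPoint hg'.2 i i.2.le
    simp only [Nat.odd_iff] at *
    omega
  have h4 : ¬ Even (crownBlock p g i).card := by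
    rw [card_crownBlock, Nat.not_even_iff_odd]; exact hg'.2 i
  rw [blockWeight, if_neg h4, card_crownBlock]
  simp only [h3] at h1 h2
  by_cases h5 : Odd (crownVal p + i)
  · rw [if_pos h5] at h1 h2 ⊢
    rw [if_neg]
    convert Nat.not_lt.2 (Nat.le_succ m)
  · rw [if_neg h5] at h1 h2 ⊢
    rw [if_pos]
    convert Nat.lt_succ_self m

theorem decompositionWeight_crownPartition (p : Crown (n + 1))
    (hg : g ∈ oddMaps (2 * n + 1 + 1) k) : decompositionWeight (crownPartition p g) =
      ∏ i : Fin k, (if Odd (crownVal p + i) then wPlus else wMinus)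
        ((Finset.univ.filter fun j => g j = i).card / 2) := by
  rw [decompositionWeight, parts_crownPartition p hg,
    Finset.prod_image fun i _ i' _ h => crownBlock_injective p hg h]
  exact Finset.prod_congr rfl fun i _ => blockWeight_crownBlock p hg i

theorem connected_crownBlock (p : Crown (n + 1)) (hg : g ∈ oddMaps (2 * n + 1 + 1) k)
    (i : Fin k) : (SimpleGraph.fromRel fun a b : crownBlock p g i => a ≤ b).Connected := by
  refine connected_crown_interval _ p (crownBlock_nonempty p hg i) fun u hu w hw v huv hvw => ?_
  rw [mem_crownBlock] at *
  have hm := (mem_oddMaps.1 hg).1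
  exact le_antisymm (hw ▸ hm hvw) (hu ▸ hm huv)

/-- An element comparable to something outside its block is an end of the arc, and both ends of an
odd arc have the same type. -/
theorem odd_crownIdx_of_boundary (p : Crown (n + 1)) (hg : g ∈ oddMaps (2 * n + 1 + 1) k)
    {i : Fin k} {v w : Crown (n + 1)} (hv : v ∈ crownBlock p g i) (hw : w ∉ crownBlock p g i)
    (h : v ≤ w ∨ w ≤ v) : Odd (crownVal v) ↔ Odd (crownVal p + i) := by
  have hg' := mem_oddMaps.1 hg
  have hne : v ≠ w := by rintro rfl; exact hw hv
  rw [mem_crownBlock, eq_iff_cutPoint hg'.1] at hv hw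
  have h1 := (crownIdx_of_comparable p h).resolve_left hne
  have h2 := cutPoint_le g (i + 1)
  have h3 := odd_cutPoint hg'.2 i i.2.le
  have h4 := odd_cutPoint hg'.2 (i + 1) i.2
  rw [odd_crownVal_iff p]
  simp only [Nat.odd_iff] at *
  omega

/-- Towards other blocks, a block with lower ends is only below and one with upper ends only above.
No block is both, so cycles cannot occur. -/
theorem isStandardDecomposition_crownPartition (p : Crown (n + 1))
    (hg : g ∈ oddMaps (2 * n + 1 + 1) k) : IsStandardDecomposition (crownPartition p g) := by
  have hle : ∀ i i', i ≠ i' → BlockLE (crownBlock p g i) (crownBlock p g i') →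
      Odd (crownVal p + i) ∧ ¬ Odd (crownVal p + i') := by
    rintro i i' hne ⟨a, ha, b, hb, hab⟩
    have hab' : a ≠ b := by
      rintro rfl
      rw [mem_crownBlock] at ha hb
      exact hne (ha.symm.trans hb)
    have h1 := even_crownVal_of_lt hab hab'
    have h2 : b ∉ crownBlock p g i := by
      rw [mem_crownBlock] at *
      rw [hb]; exact hne.symm
    have h3 : a ∉ crownBlock p g i' := by
      rw [mem_crownBlock] at *
      rw [ha]; exact hne
    rw [← odd_crownIdx_of_boundary p hg ha h2 (Or.inl hab),
      ← odd_crownIdx_of_boundary p hg hb h3 (Or.inr hab), Nat.not_odd_iff_even]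
    exact h1
  refine ⟨fun s hs => ?_, ?_⟩
  · rw [parts_crownPartition p hg, Finset.mem_image] at hs
    obtain ⟨i, -, rfl⟩ := hs
    exact ⟨connected_crownBlock p hg i, ordConnected_crown _⟩
  · rintro ⟨r, q, hr, hq, hmem, hle'⟩
    have h1 : ∀ x, ∃ i, crownBlock p g i = q x := fun x => by
      have := hmem x
      rw [parts_crownPartition p hg, Finset.mem_image] at this
      obtain ⟨i, -, hi⟩ := this
      exact ⟨i, hi⟩
    choose f hf using h1
    have hrot : ∀ x : Fin r, x ≠ finRotate r x := by
      intro x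
      obtain ⟨r, rfl⟩ : ∃ r', r = r' + 2 := ⟨r - 2, by omega⟩
      rw [finRotate_apply]
      intro hx
      simp at hx
    have h2 : ∀ x, Odd (crownVal p + f x) ∧ ¬ Odd (crownVal p + f (finRotate r x)) := by
      intro x
      refine hle _ _ ?_ ?_
      · intro h
        refine hrot x (hq ?_)
        rw [← hf, ← hf, h]
      · rw [hf, hf]
        exact hle' x
    let x : Fin r := ⟨0, by omega⟩
    exact (h2 x).2 (h2 (finRotate r x)).1

theorem mem_SDecompo {P : Type} [PartialOrder P] [Fintype P] [DecidableEq P] {k : ℕ}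
    {μ : Finpartition (Finset.univ : Finset P)} :
    μ ∈ SDecompo P k ↔ IsStandardDecomposition μ ∧ μ.parts.card = k := by
  simp [SDecompo]

theorem crownPartition_mem_SDecompo (p : Crown (n + 1))
    (hg : g ∈ oddMaps (2 * n + 1 + 1) k) : crownPartition p g ∈ SDecompo (Crown (n + 1)) k := by
  refine mem_SDecompo.2 ⟨isStandardDecomposition_crownPartition p hg, ?_⟩
  rw [parts_crownPartition p hg, Finset.card_image_of_injective _ (crownBlock_injective p hg)]
  simp

/-- Otherwise the monotone `g` has equal values at its first and last index, hence is constant,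
against `k ≥ 2`. -/
theorem crownPred_notMem_part (p : Crown (n + 1)) (hg : g ∈ oddMaps (2 * n + 1 + 1) k)
    (hk : 2 ≤ k) : crownPred p ∉ (crownPartition p g).part p := by
  rw [part_crownPartition, mem_crownBlock, crownIdx_pred_self, crownIdx_self]
  intro h
  have hm := (mem_oddMaps.1 hg).1
  have hc : ∀ j, g j = g 0 := fun j => le_antisymm (h ▸ hm (Fin.le_last j)) (hm (Fin.zero_le j))
  obtain ⟨j, hj⟩ := surjective_of_mem_oddMaps hg ⟨0, by omega⟩
  obtain ⟨j', hj'⟩ := surjective_of_mem_oddMaps hg ⟨1, by omega⟩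
  rw [hc] at hj hj'
  rw [hj] at hj'
  simp at hj'

/-- Equal kernels give a relabelling `φ` of `Fin k`; it is strictly monotone and surjective, hence
the identity. -/
theorem eq_of_crownPartition_eq (p : Crown (n + 1)) {g' : Fin (2 * n + 1 + 1) → Fin k}
    (hg : g ∈ oddMaps (2 * n + 1 + 1) k) (hg' : g' ∈ oddMaps (2 * n + 1 + 1) k)
    (h : crownPartition p g = crownPartition p g') : g = g' := by
  have hiff : ∀ x y, g x = g y ↔ g' x = g' y := by
    intro x y
    have h1 := congrArg (fun μ => (crownIdx p).symm x ∈ μ.part ((crownIdx p).symm y)) h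
    simpa [part_crownPartition, mem_crownBlock] using h1
  have hs := surjective_of_mem_oddMaps hg
  have hs' := surjective_of_mem_oddMaps hg'
  let φ : Fin k → Fin k := fun i => g' (Function.surjInv hs i)
  have hφ : ∀ x, φ (g x) = g' x := fun x => (hiff _ _).1 (Function.surjInv_eq hs _)
  have hmono : StrictMono φ := by
    intro i i' hii
    obtain ⟨x, rfl⟩ := hs i
    obtain ⟨y, rfl⟩ := hs i'
    rw [hφ, hφ]
    have hxy : x ≤ y := by
      by_contra hcon
      exact absurd ((mem_oddMaps.1 hg).1 (not_le.1 hcon).le) (not_le.2 hii)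
    exact lt_of_le_of_ne ((mem_oddMaps.1 hg').1 hxy) fun he => hii.ne ((hiff _ _).2 he)
  have hsurj : Function.Surjective φ := fun i => by
    obtain ⟨x, hx⟩ := hs' i
    exact ⟨g x, by rw [hφ, hx]⟩
  have hid : φ = id := (hmono.range_inj strictMono_id).1 (by
    rw [hsurj.range_eq, Set.range_id])
  funext x
  rw [← hφ, hid, id]

theorem exists_crownPartition_eq (p : Crown (n + 1))
    (μ : Finpartition (Finset.univ : Finset (Crown (n + 1))))
    (hμ : μ ∈ SDecompo (Crown (n + 1)) k) (ho : ∀ s ∈ μ.parts, Odd s.card)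
    (hp : crownPred p ∉ μ.part p) :
    ∃ g ∈ oddMaps (2 * n + 1 + 1) k, crownPartition p g = μ := by
  classical
  rw [mem_SDecompo] at hμ
  -- Each block is labelled by the rank of its least index counted from `p`. As no block crosses the
  -- cut before `p`, blocks are intervals and the labelling is monotone.
  let F : Finset (Crown (n + 1)) → ℕ := fun s => sInf ((fun v => (crownIdx p v).val) '' s)
  have hF : ∀ s ∈ μ.parts, ∃ v ∈ s, (crownIdx p v).val = F s := by
    intro s hs
    obtain ⟨v, hv, h⟩ := Nat.sInf_mem
      (Set.Nonempty.image (fun v => (crownIdx p v).val) (μ.nonempty_of_mem_parts hs))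
    exact ⟨v, hv, h⟩
  have hFle : ∀ s, ∀ v ∈ s, F s ≤ (crownIdx p v).val := fun s v hv =>
    Nat.sInf_le ⟨v, hv, rfl⟩
  have hFinj : Set.InjOn F μ.parts := by
    intro s hs s' hs' h
    obtain ⟨v, hv, h1⟩ := hF s hs
    obtain ⟨v', hv', h1'⟩ := hF s' hs'
    have : v = v' := (crownIdx p).injective (Fin.ext (by rw [h1, h1', h]))
    exact μ.eq_of_mem_parts hs hs' hv (this ▸ hv')
  have hcard : (μ.parts.image F).card = k := by
    rw [Finset.card_image_of_injOn hFinj, hμ.2]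
  have hpart : ∀ v, μ.part v ∈ μ.parts := fun v => μ.part_mem.2 (Finset.mem_univ _)
  have hself : ∀ v, v ∈ μ.part v := fun v => μ.mem_part_self.2 (Finset.mem_univ _)
  have hFmem : ∀ v, F (μ.part v) ∈ μ.parts.image F := fun v =>
    Finset.mem_image_of_mem _ (hpart v)
  let e := (μ.parts.image F).orderIsoOfFin hcard
  let g : Fin (2 * n + 1 + 1) → Fin k := fun j =>
    e.symm ⟨F (μ.part ((crownIdx p).symm j)), hFmem _⟩
  have hgeq : ∀ v w, g (crownIdx p v) = g (crownIdx p w) ↔ μ.part v = μ.part w := by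
    intro v w
    simp only [g, Equiv.symm_apply_apply, EmbeddingLike.apply_eq_iff_eq, Subtype.mk.injEq]
    exact ⟨fun h => hFinj (hpart v) (hpart w) h, fun h => by rw [h]⟩
  have hblock : ∀ v, crownBlock p g (g (crownIdx p v)) = μ.part v := by
    intro v
    ext w
    rw [mem_crownBlock, hgeq, μ.mem_part_iff_part_eq_part (Finset.mem_univ _) (Finset.mem_univ _)]
  have hsurj : Function.Surjective g := by
    intro i
    obtain ⟨s, hs, h⟩ := Finset.mem_image.1 (e i).2
    obtain ⟨v, hv⟩ := μ.nonempty_of_mem_parts hs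
    refine ⟨crownIdx p v, ?_⟩
    simp only [g, Equiv.symm_apply_apply]
    rw [OrderIso.symm_apply_eq]
    refine Subtype.ext (Eq.trans ?_ h)
    exact congrArg F (μ.part_eq_of_mem hs hv)
  have hmono : Monotone g := by
    intro x y hxy
    obtain ⟨v, rfl⟩ := (crownIdx p).surjective x
    obtain ⟨w, rfl⟩ := (crownIdx p).surjective y
    by_contra hcon
    have hlt : F (μ.part w) < F (μ.part v) := by
      simp only [g, Equiv.symm_apply_apply] at hcon
      rw [not_le, e.symm.lt_iff_lt] at hcon
      exact hcon
    obtain ⟨u, hu, h1⟩ := hF _ (hpart w)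
    have hcut : ¬ (p ∈ μ.part w ∧ crownPred p ∈ μ.part w) := by
      rintro ⟨h2, h3⟩
      rw [← μ.part_eq_of_mem (hpart w) h2] at h3
      exact hp h3
    have h2 := hFle _ _ (hself v)
    have h3 := mem_of_connected_crown (hμ.1.1 _ (hpart w)).1 p hcut hu (hself w)
      (Fin.le_def.2 (by rw [h1]; omega)) hxy
    rw [μ.part_eq_of_mem (hpart w) h3] at hlt
    exact lt_irrefl _ hlt
  refine ⟨g, mem_oddMaps.2 ⟨hmono, fun i => ?_⟩, ?_⟩
  · obtain ⟨j, rfl⟩ := hsurj i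
    obtain ⟨v, rfl⟩ := (crownIdx p).surjective j
    rw [← card_crownBlock p, hblock]
    exact ho _ (hpart v)
  · ext s
    rw [Finpartition.parts_eq_image_part, Finpartition.parts_eq_image_part μ]
    have h : (crownPartition p g).part = μ.part := by
      funext v
      rw [part_crownPartition, hblock]
    rw [h]

open Classical in
theorem sum_decompositionWeight_start (p : Crown (n + 1)) (hk : 2 ≤ k) :
    ∑ μ ∈ (SDecompo (Crown (n + 1)) k).filter
        (fun μ => (∀ s ∈ μ.parts, Odd s.card) ∧ crownPred p ∉ μ.part p), decompositionWeight μ =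
      ∑ g ∈ oddMaps (2 * n + 1 + 1) k, ∏ i : Fin k,
        (if Odd (crownVal p + i) then wPlus else wMinus)
          ((Finset.univ.filter fun j => g j = i).card / 2) := by
  symm
  refine Finset.sum_bij (fun g _ => crownPartition p g) ?_ ?_ ?_ ?_
  · intro g hg
    refine Finset.mem_filter.2 ⟨crownPartition_mem_SDecompo p hg, fun s hs => ?_,
      crownPred_notMem_part p hg hk⟩
    rw [parts_crownPartition p hg, Finset.mem_image] at hs
    obtain ⟨i, -, rfl⟩ := hs
    rw [card_crownBlock]
    exact (mem_oddMaps.1 hg).2 i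
  · intro g hg g' hg' h
    exact eq_of_crownPartition_eq p hg hg' h
  · intro μ hμ
    rw [Finset.mem_filter] at hμ
    obtain ⟨g, hg, h⟩ := exists_crownPartition_eq p μ hμ.1 hμ.2.1 hμ.2.2
    exact ⟨g, hg, h⟩
  · intro g hg
    exact (decompositionWeight_crownPartition p hg).symm

/-! ### Double counting of decompositions with a marked start. -/

theorem card_starts (hk : 2 ≤ k) {μ : Finpartition (Finset.univ : Finset (Crown (n + 1)))}
    (hμ : μ ∈ SDecompo (Crown (n + 1)) k) :
    (Finset.univ.filter fun p => crownPred p ∉ μ.part p).card = k := by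
  classical
  rw [mem_SDecompo] at hμ
  rw [Finset.card_eq_sum_card_fiberwise (f := μ.part) (t := μ.parts)
    fun p _ => μ.part_mem.2 (Finset.mem_univ _)]
  rw [Finset.sum_congr rfl (g := fun _ => 1), Finset.sum_const, hμ.2, smul_eq_mul, mul_one]
  intro s hs
  refine Eq.trans (congrArg Finset.card ?_) (card_start_eq_one (hμ.1.1 s hs).1 ?_)
  · ext p
    simp only [Finset.mem_filter, Finset.mem_univ, true_and, μ.part_eq_iff_mem hs]
    constructor
    · rintro ⟨h1, h2⟩
      rw [μ.part_eq_of_mem hs h2] at h1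
      exact ⟨h2, h1⟩
    · rintro ⟨h1, h2⟩
      rw [μ.part_eq_of_mem hs h1]
      exact ⟨h2, h1⟩
  · rintro rfl
    obtain ⟨s', hs', hne⟩ := Finset.exists_mem_ne (by omega : 1 < μ.parts.card) Finset.univ
    obtain ⟨v, hv⟩ := μ.nonempty_of_mem_parts hs'
    exact hne (μ.eq_of_mem_parts hs' hs hv (Finset.mem_univ v))

theorem decompositionWeight_eq_zero {P : Type} [PartialOrder P] [Fintype P] [DecidableEq P]
    {μ : Finpartition (Finset.univ : Finset P)} (h : ¬ ∀ s ∈ μ.parts, Odd s.card) :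
    decompositionWeight μ = 0 := by
  push Not at h
  obtain ⟨s, hs, h⟩ := h
  refine Finset.prod_eq_zero hs ?_
  rw [blockWeight, if_pos (Nat.not_odd_iff_even.1 h)]

/-- An odd number of odd blocks cannot cover the `2n + 2` elements. -/
theorem sum_decompositionWeight_of_odd (hk : Odd k) :
    ∑ μ ∈ SDecompo (Crown (n + 1)) k, decompositionWeight μ = 0 := by
  refine Finset.sum_eq_zero fun μ hμ => decompositionWeight_eq_zero fun ho => ?_
  rw [mem_SDecompo] at hμ
  have h1 := μ.sum_card_parts
  have h2 : Odd (∑ s ∈ μ.parts, s.card) := by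
    rw [Finset.odd_sum_iff_odd_card_odd, Finset.filter_true_of_mem ho, hμ.2]
    exact hk
  rw [h1, Finset.card_univ] at h2
  have h3 : Fintype.card (Crown (n + 1)) = 2 * (n + 1) := Fintype.card_fin _
  rw [h3] at h2
  exact Nat.not_odd_iff_even.2 (even_two_mul _) h2

/-- The parity of `c` only decides which factor comes first, so the weight sum will not depend on
the start `p`. -/
theorem prod_alternating {R : Type*} [CommMonoid R] (A B : R) (c m : ℕ) :
    ∏ i : Fin (2 * m), (if Odd (c + i.val) then A else B) = (A * B) ^ m := by
  rw [Fin.prod_univ_eq_prod_range fun i => if Odd (c + i) then A else B]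
  induction m with
  | zero => simp
  | succ m ih =>
    rw [show 2 * (m + 1) = 2 * m + 1 + 1 by ring, Finset.prod_range_succ, Finset.prod_range_succ,
      ih, pow_succ, mul_assoc]
    congr 1
    by_cases h : Odd c
    · rw [if_pos (by rw [Nat.odd_iff] at *; omega), if_neg (by rw [Nat.odd_iff] at *; omega)]
    · rw [if_neg (by rw [Nat.odd_iff] at *; omega), if_pos (by rw [Nat.odd_iff] at *; omega),
        mul_comm]

theorem sum_oddMaps_alternating {N m d : ℕ} (hN : N = 2 * d + 2 * m) (c : ℕ) :
    ∑ g ∈ oddMaps N (2 * m), ∏ i : Fin (2 * m),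
        (if Odd (c + i.val) then wPlus else wMinus)
          ((Finset.univ.filter fun j => g j = i).card / 2) =
      PowerSeries.coeff (d + m) (arcsinSq ^ m) := by
  subst hN
  rw [sum_oddMaps d (2 * m) fun i => if Odd (c + i.val) then wPlus else wMinus]
  have h : ∀ i : Fin (2 * m), PowerSeries.mk (if Odd (c + i.val) then wPlus else wMinus) =
      if Odd (c + i.val) then wPlusSeries else wMinusSeries := fun i => by
    split_ifs <;> rfl
  simp only [h]
  rw [prod_alternating, arcsinSq_eq, mul_pow PowerSeries.X, PowerSeries.coeff_X_pow_mul',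
    if_pos (by omega), Nat.add_sub_cancel]

/-- Weighted pairs of a decomposition and one of its starts are counted by decomposition (`2m`
starts each) and by start (`2n + 2` elements with the same sum). -/
theorem sum_decompositionWeight_even {m : ℕ} (hm : m ≠ 0) (hmn : m ≤ n + 1) :
    (2 * m : ℚ) * ∑ μ ∈ SDecompo (Crown (n + 1)) (2 * m), decompositionWeight μ =
      (2 * (n + 1) : ℚ) * PowerSeries.coeff (n + 1) (arcsinSq ^ m) := by
  classical
  have h1 : ∑ μ ∈ SDecompo (Crown (n + 1)) (2 * m), decompositionWeight μ =
      ∑ μ ∈ (SDecompo (Crown (n + 1)) (2 * m)).filter (fun μ => ∀ s ∈ μ.parts, Odd s.card),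
        decompositionWeight μ := by
    rw [Finset.sum_filter]
    refine Finset.sum_congr rfl fun μ _ => ?_
    split_ifs with h
    · rfl
    · exact decompositionWeight_eq_zero h
  have h2 : ∀ p : Crown (n + 1), ∑ μ ∈ (SDecompo (Crown (n + 1)) (2 * m)).filter
        (fun μ => ∀ s ∈ μ.parts, Odd s.card),
        (if crownPred p ∉ μ.part p then decompositionWeight μ else 0) =
      PowerSeries.coeff (n + 1) (arcsinSq ^ m) := by
    intro p
    rw [← Finset.sum_filter, Finset.filter_filter]
    refine (sum_decompositionWeight_start p (by omega)).trans ?_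
    rw [sum_oddMaps_alternating (d := n + 1 - m) (by omega), Nat.sub_add_cancel hmn]
  have h3 := Finset.sum_congr (rfl : (Finset.univ : Finset (Crown (n + 1))) = Finset.univ)
    fun p _ => h2 p
  have h4 : Fintype.card (Crown (n + 1)) = 2 * (n + 1) := Fintype.card_fin _
  rw [Finset.sum_const, Finset.card_univ, h4, Finset.sum_comm, nsmul_eq_mul] at h3
  push_cast at h3
  rw [← h3, h1, Finset.mul_sum]
  refine Finset.sum_congr rfl fun μ hμ => ?_
  rw [← Finset.sum_filter, Finset.sum_const,
    card_starts (by omega) (Finset.mem_filter.1 hμ).1, nsmul_eq_mul]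
  push_cast
  rfl

end CrownDecompositions

theorem mainTheorem9 (n k : ℕ) (hn : 1 ≤ n) (hk : 1 ≤ k) (hkn : k ≤ 2 * n) :
    fHat n k =
      (Nat.factorial (2 * n) : ℚ) / (2 * (Nat.factorial (k - 1) : ℚ)) * (eulerE (k - 1) : ℚ) *
        ∑ μ ∈ SDecompo (Crown n) k, decompositionWeight μ := by
  obtain ⟨n, rfl⟩ : ∃ n', n = n' + 1 := ⟨n - 1, by omega⟩
  rcases Nat.even_or_odd' k with ⟨m, rfl | rfl⟩
  · obtain ⟨m, rfl⟩ : ∃ m', m = m' + 1 := ⟨m - 1, by omega⟩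
    have h := sum_decompositionWeight_even (n := n) (m := m + 1) (by omega) (by omega)
    have hm : (m + 1 : ℚ) ≠ 0 := by positivity
    have hf : (Nat.factorial (2 * (m + 1)) : ℚ) =
        2 * (m + 1) * Nat.factorial (2 * m + 1) := by
      rw [show 2 * (m + 1) = 2 * m + 1 + 1 by ring, Nat.factorial_succ]
      push_cast; ring
    have hf0 : (Nat.factorial (2 * m + 1) : ℚ) ≠ 0 := by exact_mod_cast Nat.factorial_ne_zero _
    rw [fHat_even n (m + 1) (by omega), coeff_logSecSqrt_eq, hf,
      show 2 * (m + 1) - 1 = 2 * m + 1 by omega]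
    push_cast at h
    set S := ∑ μ ∈ SDecompo (Crown (n + 1)) (2 * (m + 1)), decompositionWeight μ
    have hS : S = (n + 1) * PowerSeries.coeff (n + 1) (arcsinSq ^ (m + 1)) / (m + 1) := by
      field_simp
      linarith
    rw [hS]
    field_simp
  · rw [fHat_of_odd n _ (odd_two_mul_add_one m),
      sum_decompositionWeight_of_odd (odd_two_mul_add_one m), mul_zero]
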